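/- **Setting.** Let $\mathcal M=(\mathcal S,\mathcal A,\mathcal P,\mathbf r,\gamma)$ be a discounted Markov decision problem with finite state space $\mathcal S$, finite action space $\mathcal A$, transition probabilities $p_{ij}(a)$, rewards $r_{ij}(a)\in[0,1]$ and discount factor $\gamma\in(0,1)$. Write $r_a(i)=\sum_j p_{ij}(a)r_{ij}(a)$, and let $v^*_i=\sup_\pi \mathbf E^\pi\big[\sum_{t\ge 0}\gamma^t r_{i_ti_{t+1}}(a_t)\mid i_0=i\big]$ be the optimal value, the supremum being over stationary randomized policies. For a probability vector $q\in\mathbb R^{\mathcal S}$ the dual linear program is $$\text{maximize }\sum_{i,a}\mu_{i,a}r_a(i)\quad\text{subject to}\quad \sum_a\Big(\mu_{i,a}-\gamma\sum_k p_{ki}(a)\mu_{k,a}\Big)=(1-\gamma)q_i\ \ (i\in\mathcal S),\quad \mu\ge 0,$$ and $\mathcal U_{\theta,q}=\{\mu\ge 0:\ \sum_{i,a}\mu_{i,a}=1,\ \sum_a\mu_{i,a}\ge\theta q_i\ \text{for all } i\}$. **Randomized primal-dual method with input $(\mathcal M,q,\theta)$ and $T\ge 1$ iterations.** Put $M=\frac1{1-\gamma}$,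 $\beta=(1-\gamma)\sqrt{\frac{\ell}{2|\mathcal S||\mathcal A|T}}$ and $\alpha=\frac{|\mathcal S|}{2(1-\gamma)^2}\beta$, where $\ell$ is either of the two numbers $\log(|\mathcal S||\mathcal A|+1)$ and $\log(|\mathcal S||\mathcal A|)+1$. Start with $v=0$, $\xi_i=1/|\mathcal S|$, $\pi_{i,a}=1/|\mathcal A|$. In iteration $t=1,\dots,T$, with current variables $(v,\xi,\pi)=(v^t,\xi^t,\pi^t)$, sample $i$ with probability $w_i=(1-\theta)\xi_i+\theta q_i$, then $a$ with probability $\pi_{i,a}$, then $j$ with probability $p_{ij}(a)$, set $$\Delta=\beta\,\frac{\gamma v_j-v_i+r_{ij}(a)-M}{w_i\,\pi_{i,a}},$$ and update, in this order, $$v_i\leftarrow\max\Big\{\min\Big\{v_i-\alpha\Big(\frac{(1-\gamma)q_i}{w_i}-1\Big),\frac1{1-\gamma}\Big\},0\Big\},\qquad v_j\leftarrow\max\Big\{\min\Big\{v_j-\alpha\gamma,\frac1{1-\gamma}\Big\},0\Big\},$$ $$\xi_i\leftarrow\xi_i+\xi_i\pi_{i,a}(e^{\Delta}-1),\quad \xi\leftarrow\xi/\|\xi\|_1,\qquad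 \pi_{i,a}\leftarrow\pi_{i,a}e^{\Delta},\quad \pi_i\leftarrow\pi_i/\|\pi_i\|_1 .$$ **Proposition (Duality Gap Bound).** Let $\mathcal M$ be an arbitrary such problem, $q$ an arbitrary probability vector and $\theta\ge 1-\gamma$, and assume that the dual linear program has an optimal solution $\mu^*\in\mathcal U_{\theta,q}$. Then the averaged dual iterate $\hat\mu_{i,a}=\frac1T\sum_{t=1}^T\big((1-\theta)\xi^t_i+\theta q_i\big)\pi^t_{i,a}$ satisfies $$\mathbf E\Big[\sum_{i\in\mathcal S,\,a\in\mathcal A}\hat\mu_{i,a}\Big(v^*_i-\gamma\sum_{j}p_{ij}(a)v^*_j-\sum_jp_{ij}(a)r_{ij}(a)\Big)\Big]\ \le\ \frac{3\sqrt{|\mathcal S|(|\mathcal A|+1)\big(\log(|\mathcal S||\mathcal A|)+1\big)}}{(1-\gamma)\sqrt T}.$$ -/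

import Mathlib

noncomputable section

/-- A discounted Markov decision problem with state space `S` and action space `A`:
`p i a j` is the probability of moving from `i` to `j` under action `a`, `r i a j ∈ [0,1]` is the
reward of that transition, and `γ ∈ (0,1)` is the discount factor. -/
structure DMDP (S A : Type*) [Fintype S] where
  p : S → A → S → ℝ
  r : S → A → S → ℝ
  γ : ℝ
  p_nonneg : ∀ i a j, 0 ≤ p i a j
  p_sum : ∀ i a, ∑ j, p i a j = 1
  r_nonneg : ∀ i a j, 0 ≤ r i a j
  r_le_one : ∀ i a j, r i a j ≤ 1
  γ_pos : 0 < γ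
  γ_lt_one : γ < 1

/-- A stationary randomized policy: a probability distribution on actions for every state. -/
def RandomizedPolicy (S A : Type*) [Fintype A] : Type _ :=
  {π : S → A → ℝ // ∀ i, π i ∈ stdSimplex ℝ A}

/-- The set `U_{θ,q}` of probability vectors `μ` on `S × A` with `∑ a, μ i a ≥ θ q i`. -/
def dualSet {S A : Type*} [Fintype S] [Fintype A] (θ : ℝ) (q : S → ℝ) : Set (S → A → ℝ) :=
  {μ | ∑ i, ∑ a, μ i a = 1 ∧ (∀ i a, 0 ≤ μ i a) ∧ ∀ i, θ * q i ≤ ∑ a, μ i a}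

/-- The variables of the randomized primal-dual method: the value vector `v`, the state
distribution `ξ`, and the randomized policy `π`. -/
structure Iterate (S A : Type*) where
  v : S → ℝ
  ξ : S → ℝ
  π : S → A → ℝ

namespace DMDP

variable {S A : Type*} [Fintype S] [Fintype A] [DecidableEq S] [DecidableEq A]

/-- Expected one-step reward `r_a(i)`. -/
def expReward (M : DMDP S A) (i : S) (a : A) : ℝ := ∑ j, M.p i a j * M.r i a j

/-- Transition matrix `P^π` of the Markov chain on states under the policy `π`. -/
def policyMatrix (M : DMDP S A) (π : RandomizedPolicy S A) : Matrix S S ℝ :=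
  Matrix.of fun i j => ∑ a, π.1 i a * M.p i a j

/-- Expected one-step reward under the policy `π`. -/
def policyReward (M : DMDP S A) (π : RandomizedPolicy S A) (i : S) : ℝ :=
  ∑ a, π.1 i a * M.expReward i a

/-- The expected discounted cumulative reward `∑_{t ≥ 0} γ^t E^π[r_t | i_0 = i]`; the expected
reward at time `t` of the chain started at `i` is the `i`-th entry of `(P^π)^t r^π`. -/
def value (M : DMDP S A) (π : RandomizedPolicy S A) (i : S) : ℝ :=
  ∑' t : ℕ, M.γ ^ t * (M.policyMatrix π ^ t).mulVec (M.policyReward π) i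

/-- The optimal value vector: the supremum of the values of all randomized policies. -/
def optValue (M : DMDP S A) (i : S) : ℝ := ⨆ π : RandomizedPolicy S A, M.value π i

/-- Feasibility in the dual linear program:
`∑ a, (I - γ P_aᵀ) μ_a = (1 - γ) q` and `μ ≥ 0`. -/
def IsDualFeasible (M : DMDP S A) (q : S → ℝ) (μ : S → A → ℝ) : Prop :=
  (∀ i a, 0 ≤ μ i a) ∧
    ∀ i, ∑ a, (μ i a - M.γ * ∑ k, M.p k a i * μ k a) = (1 - M.γ) * q i

/-- The objective `∑ a, μ_aᵀ r_a` of the dual linear program. -/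
def dualObjective (M : DMDP S A) (μ : S → A → ℝ) : ℝ := ∑ i, ∑ a, μ i a * M.expReward i a

/-- `μ` is an optimal solution of the dual linear program. -/
def IsDualOptimal (M : DMDP S A) (q : S → ℝ) (μ : S → A → ℝ) : Prop :=
  M.IsDualFeasible q μ ∧ ∀ ν, M.IsDualFeasible q ν → M.dualObjective ν ≤ M.dualObjective μ

/-- Truncation to `[0, 1/(1-γ)]`. -/
def clip (M : DMDP S A) (x : ℝ) : ℝ := max (min x (1 / (1 - M.γ))) 0

/-- The probability `(1-θ) ξ_i + θ q_i` with which the state `i` is sampled. -/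
def stateWeight (θ : ℝ) (q : S → ℝ) (x : Iterate S A) (i : S) : ℝ := (1 - θ) * x.ξ i + θ * q i

/-- The implicit dual iterate `μ_{i,a} = ((1-θ) ξ_i + θ q_i) π_{i,a}`. -/
def dualIterate (θ : ℝ) (q : S → ℝ) (x : Iterate S A) (i : S) (a : A) : ℝ :=
  stateWeight θ q x i * x.π i a

/-- The probability of drawing the triple `(i, a, j)` at the current iterate: first `i` with
probability `(1-θ) ξ_i + θ q_i`, then `a` with probability `π_{i,a}`, then `j` with probability
`p_{ij}(a)`. -/
def sampleProb (M : DMDP S A) (θ : ℝ) (q : S → ℝ) (x : Iterate S A) (z : S × A × S) : ℝ :=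
  stateWeight θ q x z.1 * x.π z.1 z.2.1 * M.p z.1 z.2.1 z.2.2

/-- The exponent `Δ = β (γ v_j - v_i + r_{ij}(a) - 1/(1-γ)) / (((1-θ) ξ_i + θ q_i) π_{i,a})`. -/
def delta (M : DMDP S A) (θ : ℝ) (q : S → ℝ) (β : ℝ) (x : Iterate S A) (z : S × A × S) : ℝ :=
  β * ((M.γ * x.v z.2.2 - x.v z.1 + M.r z.1 z.2.1 z.2.2 - 1 / (1 - M.γ)) /
    dualIterate θ q x z.1 z.2.1)

/-- The update of `v` after drawing `z = (i, a, j)`: first the coordinate `i`, then the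
coordinate `j`. -/
def stepV (M : DMDP S A) (θ : ℝ) (q : S → ℝ) (α : ℝ) (x : Iterate S A) (z : S × A × S) : S → ℝ :=
  let v₁ : S → ℝ := Function.update x.v z.1
    (M.clip (x.v z.1 - α * ((1 - M.γ) * q z.1 / stateWeight θ q x z.1 - 1)))
  Function.update v₁ z.2.2 (M.clip (v₁ z.2.2 - α * M.γ))

/-- The exponentiated update of `ξ` after drawing `z = (i, a, j)`, followed by normalization in
the 1-norm. -/
def stepXi (M : DMDP S A) (θ : ℝ) (q : S → ℝ) (β : ℝ) (x : Iterate S A) (z : S × A × S) : S → ℝ :=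
  let ξ₁ : S → ℝ := Function.update x.ξ z.1
    (x.ξ z.1 + x.ξ z.1 * x.π z.1 z.2.1 * (Real.exp (M.delta θ q β x z) - 1))
  fun k => ξ₁ k / ∑ l, |ξ₁ l|

/-- The exponentiated update of the row `π_i` after drawing `z = (i, a, j)`, followed by
normalization in the 1-norm; the other rows do not change. -/
def stepPi (M : DMDP S A) (θ : ℝ) (q : S → ℝ) (β : ℝ) (x : Iterate S A) (z : S × A × S) :
    S → A → ℝ :=
  let row : A → ℝ := Function.update (x.π z.1) z.2.1
    (x.π z.1 z.2.1 * Real.exp (M.delta θ q β x z))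
  Function.update x.π z.1 (fun b => row b / ∑ c, |row c|)

/-- One iteration of the method with sampled triple `z`; all right-hand sides `Δ`, `ξ`, `π` refer
to the iterate before the update. -/
def step (M : DMDP S A) (θ : ℝ) (q : S → ℝ) (α β : ℝ) (x : Iterate S A) (z : S × A × S) :
    Iterate S A where
  v := M.stepV θ q α x z
  ξ := M.stepXi θ q β x z
  π := M.stepPi θ q β x z

/-- The starting point: `v = 0`, and uniform distributions `ξ` and `π_i`. -/
def initIterate (S A : Type*) [Fintype S] [Fintype A] : Iterate S A where
  v := fun _ => 0
  ξ := fun _ => 1 / (Fintype.card S : ℝ)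
  π := fun _ _ => 1 / (Fintype.card A : ℝ)

/-- The iterate after `t ≤ T` iterations when the sampled triples are `ω 0, …, ω (T-1)`. In the
one-based numbering of iterates this is the iterate with index `t + 1`. -/
def iterate (M : DMDP S A) (θ : ℝ) (q : S → ℝ) (α β : ℝ) {T : ℕ} (ω : Fin T → S × A × S) :
    ℕ → Iterate S A
  | 0 => initIterate S A
  | t + 1 => if h : t < T then M.step θ q α β (M.iterate θ q α β ω t) (ω ⟨t, h⟩)
      else M.iterate θ q α β ω t

/-- The probability that the sampled triples of the `T` iterations are `ω 0, …, ω (T-1)`: the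
product of the conditional sampling probabilities given the past. -/
def pathProb (M : DMDP S A) (θ : ℝ) (q : S → ℝ) (α β : ℝ) {T : ℕ} (ω : Fin T → S × A × S) : ℝ :=
  ∏ t : Fin T, M.sampleProb θ q (M.iterate θ q α β ω t) (ω t)

/-- Expectation, over the randomness of the `T` iterations, of a function of the sampled triples
(a finite sum, as there are finitely many sample sequences). -/
def expectation (M : DMDP S A) (θ : ℝ) (q : S → ℝ) (α β : ℝ) (T : ℕ)
    (f : (Fin T → S × A × S) → ℝ) : ℝ :=
  ∑ ω : Fin T → S × A × S, M.pathProb θ q α β ω * f ω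

/-- The averaged dual iterate `μ̂ = (1/T) ∑_{t=1}^T μ^t`. -/
def avgDual (M : DMDP S A) (θ : ℝ) (q : S → ℝ) (α β : ℝ) {T : ℕ} (ω : Fin T → S × A × S)
    (i : S) (a : A) : ℝ :=
  1 / (T : ℝ) * ∑ t : Fin T, dualIterate θ q (M.iterate θ q α β ω t) i a

/-- The complementarity violation `∑ μ_{i,a} (v*_i - γ ∑_j p_{ij}(a) v*_j - ∑_j p_{ij}(a) r_{ij}(a))`
of a vector `μ`. -/
def gap (M : DMDP S A) (μ : S → A → ℝ) : ℝ :=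
  ∑ i, ∑ a, μ i a *
    (M.optValue i - M.γ * ∑ j, M.p i a j * M.optValue j - ∑ j, M.p i a j * M.r i a j)

/-- The dual step size `β = (1-γ) √(ℓ / (2 |S| |A| T))`. -/
def dualStep (M : DMDP S A) (ℓ : ℝ) (T : ℕ) : ℝ :=
  (1 - M.γ) * √(ℓ / (2 * Fintype.card S * Fintype.card A * T))

/-- The primal step size `α = |S| β / (2 (1-γ)²)`. -/
def primalStep (M : DMDP S A) (ℓ : ℝ) (T : ℕ) : ℝ :=
  Fintype.card S / (2 * (1 - M.γ) ^ 2) * M.dualStep ℓ T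

end DMDP

end

noncomputable section
set_option linter.unusedSectionVars false

namespace DMDP

variable {S A : Type*} [Fintype S] [Fintype A] [DecidableEq S] [DecidableEq A]

/-! The method is a stochastic primal-dual scheme for the Lagrangian of the linear program:
projected gradient steps in `v`, exponentiated gradient steps in `(ξ, π)`. The proof follows a
`potential`, the cross entropy of the iterate relative to `μ*` divided by `β`, plus the squared
distance from `v` to `v*` divided by `2α`.

In expectation one iteration changes the dual part by the Lagrangian difference between the iterate
`m` and `μ*` at the current `v`, and the primal part by the difference between `v*` and `v` at the
current `m`, up to second-order errors. The terms in `v` cancel because `μ*` is feasible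
(`IsDualFeasible.drift_eq`). What remains is `-gap m` plus `(1-γ) qᵀv*` minus the dual optimum, and
the latter difference is nonpositive (`le_dualObjective_of_isDualOptimal`), since the occupation
measure of an optimal policy is feasible. This is `sum_sampleProb_mul_potential_le`.

The errors stay small for two reasons. The shift by `1/(1-γ)` makes every exponent nonpositive, so
`e^Δ - 1 ≤ Δ + Δ²/2` without a step size restriction; and `θ ≥ 1-γ` keeps the importance-weighted
primal gradient in `[-1, 0]`. Telescoping (`expectation_sum_add_le`), nonnegativity of the final
potential and linearity of the gap give a bound for arbitrary step sizes, which `balanced_steps_le`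
evaluates at the prescribed ones. -/

/-! ### Minimum principle and policy evaluation. -/

/-- Minimum principle: a function that dominates its discounted average is nonnegative. -/
theorem nonneg_of_discounted_le {P : S → S → ℝ} {γ : ℝ} (h0 : ∀ i j, 0 ≤ P i j)
    (h1 : ∀ i, ∑ j, P i j = 1) (hγ0 : 0 ≤ γ) (hγ1 : γ < 1) {w : S → ℝ}
    (hw : ∀ i, γ * ∑ j, P i j * w j ≤ w i) (i : S) : 0 ≤ w i := by
  obtain ⟨k, -, hk⟩ := Finset.exists_min_image Finset.univ w ⟨i, Finset.mem_univ i⟩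
  have h : w k ≤ ∑ j, P k j * w j := by
    calc w k = ∑ j, P k j * w k := by rw [← Finset.sum_mul, h1, one_mul]
      _ ≤ _ := Finset.sum_le_sum fun j _ =>
        mul_le_mul_of_nonneg_left (hk j (Finset.mem_univ j)) (h0 k j)
  -- At a minimum point, `w k ≥ γ w k`, and `γ < 1`.
  have h2 : 0 ≤ w k := by
    nlinarith [hw k, mul_le_mul_of_nonneg_left h hγ0]
  exact h2.trans (hk i (Finset.mem_univ i))

theorem policyMatrix_nonneg (M : DMDP S A) (π : RandomizedPolicy S A) (i j : S) :
    0 ≤ M.policyMatrix π i j :=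
  Finset.sum_nonneg fun a _ => mul_nonneg ((π.2 i).1 a) (M.p_nonneg i a j)

theorem policyMatrix_sum (M : DMDP S A) (π : RandomizedPolicy S A) (i : S) :
    ∑ j, M.policyMatrix π i j = 1 := by
  simp only [policyMatrix, Matrix.of_apply]
  rw [Finset.sum_comm]
  simp_rw [← Finset.mul_sum, M.p_sum, mul_one]
  exact (π.2 i).2

theorem expReward_nonneg (M : DMDP S A) (i : S) (a : A) : 0 ≤ M.expReward i a :=
  Finset.sum_nonneg fun j _ => mul_nonneg (M.p_nonneg i a j) (M.r_nonneg i a j)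

theorem expReward_le_one (M : DMDP S A) (i : S) (a : A) : M.expReward i a ≤ 1 := by
  rw [← M.p_sum i a]
  exact Finset.sum_le_sum fun j _ => mul_le_of_le_one_right (M.p_nonneg i a j) (M.r_le_one i a j)

theorem policyReward_nonneg (M : DMDP S A) (π : RandomizedPolicy S A) (i : S) :
    0 ≤ M.policyReward π i :=
  Finset.sum_nonneg fun a _ => mul_nonneg ((π.2 i).1 a) (M.expReward_nonneg i a)

theorem policyReward_le_one (M : DMDP S A) (π : RandomizedPolicy S A) (i : S) :
    M.policyReward π i ≤ 1 := by
  rw [← (π.2 i).2]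
  exact Finset.sum_le_sum fun a _ =>
    mul_le_of_le_one_right ((π.2 i).1 a) (M.expReward_le_one i a)

theorem pow_mulVec_policyReward_mem (M : DMDP S A) (π : RandomizedPolicy S A) (t : ℕ) (i : S) :
    (M.policyMatrix π ^ t).mulVec (M.policyReward π) i ∈ Set.Icc (0 : ℝ) 1 := by
  induction t generalizing i with
  | zero => simpa using ⟨M.policyReward_nonneg π i, M.policyReward_le_one π i⟩
  | succ t ih =>
    rw [pow_succ', ← Matrix.mulVec_mulVec]
    refine ⟨Finset.sum_nonneg fun j _ => mul_nonneg (M.policyMatrix_nonneg π i j) (ih j).1, ?_⟩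
    rw [← M.policyMatrix_sum π i]
    exact Finset.sum_le_sum fun j _ =>
      mul_le_of_le_one_right (M.policyMatrix_nonneg π i j) (ih j).2

theorem summable_value (M : DMDP S A) (π : RandomizedPolicy S A) (i : S) :
    Summable fun t : ℕ => M.γ ^ t * (M.policyMatrix π ^ t).mulVec (M.policyReward π) i := by
  refine Summable.of_nonneg_of_le (fun t => ?_) (fun t => ?_)
    (summable_geometric_of_lt_one M.γ_pos.le M.γ_lt_one)
  · exact mul_nonneg (pow_nonneg M.γ_pos.le t) (M.pow_mulVec_policyReward_mem π t i).1
  · exact mul_le_of_le_one_right (pow_nonneg M.γ_pos.le t) (M.pow_mulVec_policyReward_mem π t i).2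

/-- The value of a policy solves the policy evaluation equation. -/
theorem value_eq (M : DMDP S A) (π : RandomizedPolicy S A) (i : S) :
    M.value π i = M.policyReward π i + M.γ * ∑ j, M.policyMatrix π i j * M.value π j := by
  unfold value
  rw [(M.summable_value π i).tsum_eq_zero_add]
  congr 1
  · simp
  · simp_rw [← tsum_mul_left]
    rw [← Summable.tsum_finsetSum fun j _ => (M.summable_value π j).mul_left _, ← tsum_mul_left]
    refine tsum_congr fun t => ?_
    rw [pow_succ' (M.policyMatrix π), ← Matrix.mulVec_mulVec, Matrix.mulVec, dotProduct,
      Finset.mul_sum, Finset.mul_sum]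
    exact Finset.sum_congr rfl fun j _ => by ring

theorem value_nonneg (M : DMDP S A) (π : RandomizedPolicy S A) (i : S) : 0 ≤ M.value π i :=
  nonneg_of_discounted_le (M.policyMatrix_nonneg π) (M.policyMatrix_sum π) M.γ_pos.le M.γ_lt_one
    (fun k => by linarith [M.value_eq π k, M.policyReward_nonneg π k]) i

/-- A supersolution of the policy evaluation equation dominates the value of the policy. -/
theorem value_le_of_supersolution (M : DMDP S A) (π : RandomizedPolicy S A) {u : S → ℝ}
    (hu : ∀ i, M.policyReward π i + M.γ * ∑ j, M.policyMatrix π i j * u j ≤ u i) (i : S) :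
    M.value π i ≤ u i := by
  refine sub_nonneg.1 (nonneg_of_discounted_le (w := fun k => u k - M.value π k)
    (M.policyMatrix_nonneg π) (M.policyMatrix_sum π) M.γ_pos.le M.γ_lt_one (fun k => ?_) i)
  simp only [mul_sub, Finset.sum_sub_distrib]
  linarith [hu k, M.value_eq π k]

/-- A subsolution of the policy evaluation equation is dominated by the value of the policy. -/
theorem le_value_of_subsolution (M : DMDP S A) (π : RandomizedPolicy S A) {u : S → ℝ}
    (hu : ∀ i, u i ≤ M.policyReward π i + M.γ * ∑ j, M.policyMatrix π i j * u j) (i : S) :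
    u i ≤ M.value π i := by
  refine sub_nonneg.1 (nonneg_of_discounted_le (w := fun k => M.value π k - u k)
    (M.policyMatrix_nonneg π) (M.policyMatrix_sum π) M.γ_pos.le M.γ_lt_one (fun k => ?_) i)
  simp only [mul_sub, Finset.sum_sub_distrib]
  linarith [hu k, M.value_eq π k]

theorem horizon_nonneg (M : DMDP S A) : 0 ≤ 1 / (1 - M.γ) :=
  one_div_nonneg.2 (sub_nonneg.2 M.γ_lt_one.le)

theorem horizon_eq (M : DMDP S A) : 1 / (1 - M.γ) = 1 + M.γ * (1 / (1 - M.γ)) := by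
  have : 1 - M.γ ≠ 0 := (sub_pos.2 M.γ_lt_one).ne'
  field_simp
  ring

theorem value_le (M : DMDP S A) (π : RandomizedPolicy S A) (i : S) :
    M.value π i ≤ 1 / (1 - M.γ) := by
  refine M.value_le_of_supersolution π (u := fun _ => 1 / (1 - M.γ)) (fun k => ?_) i
  rw [← Finset.sum_mul, M.policyMatrix_sum, one_mul]
  linarith [M.policyReward_le_one π k, M.horizon_eq]

/-! ### Bellman optimality. -/

/-- The value of action `a` in state `i` when the continuation values are `u`. -/
def actionValue (M : DMDP S A) (u : S → ℝ) (i : S) (a : A) : ℝ :=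
  M.expReward i a + M.γ * ∑ j, M.p i a j * u j

/-- The Bellman optimality operator. -/
def bellman [Nonempty A] (M : DMDP S A) (u : S → ℝ) (i : S) : ℝ :=
  Finset.univ.sup' Finset.univ_nonempty (M.actionValue u i)

theorem actionValue_le_add_dist (M : DMDP S A) (u v : S → ℝ) (i : S) (a : A) :
    M.actionValue u i a ≤ M.actionValue v i a + M.γ * dist u v := by
  have h : ∑ j, M.p i a j * u j ≤ ∑ j, M.p i a j * v j + dist u v := by
    calc ∑ j, M.p i a j * u j ≤ ∑ j, M.p i a j * (v j + dist u v) := by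
          refine Finset.sum_le_sum fun j _ => mul_le_mul_of_nonneg_left ?_ (M.p_nonneg i a j)
          have := (le_abs_self (u j - v j)).trans (dist_le_pi_dist u v j)
          linarith
      _ = _ := by
          simp only [mul_add, Finset.sum_add_distrib, ← Finset.sum_mul, M.p_sum, one_mul]
  unfold actionValue
  nlinarith [mul_le_mul_of_nonneg_left h M.γ_pos.le]

theorem bellman_le_add_dist [Nonempty A] (M : DMDP S A) (u v : S → ℝ) (i : S) :
    M.bellman u i ≤ M.bellman v i + M.γ * dist u v :=
  Finset.sup'_le _ _ fun a ha => (M.actionValue_le_add_dist u v i a).trans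
    (add_le_add_left (Finset.le_sup' (M.actionValue v i) ha) _)

theorem contracting_bellman [Nonempty A] (M : DMDP S A) :
    ContractingWith ⟨M.γ, M.γ_pos.le⟩ M.bellman := by
  refine ⟨M.γ_lt_one, LipschitzWith.of_dist_le_mul fun u v => ?_⟩
  refine (dist_pi_le_iff (mul_nonneg M.γ_pos.le dist_nonneg)).2 fun i => ?_
  rw [Real.dist_eq, abs_le]
  have h1 := M.bellman_le_add_dist u v i
  have h2 := M.bellman_le_add_dist v u i
  rw [dist_comm v u] at h2
  constructor
  · change -(M.γ * dist u v) ≤ _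
    linarith
  · change _ ≤ M.γ * dist u v
    linarith

/-- The deterministic policy that plays `act i` in state `i`. -/
def deterministicPolicy (act : S → A) : RandomizedPolicy S A :=
  ⟨fun i => Pi.single (act i) 1, fun i => single_mem_stdSimplex ℝ (act i)⟩

theorem policyMatrix_deterministicPolicy (M : DMDP S A) (act : S → A) (i j : S) :
    M.policyMatrix (deterministicPolicy act) i j = M.p i (act i) j := by
  simp [policyMatrix, deterministicPolicy, Pi.single_apply]

theorem policyReward_deterministicPolicy (M : DMDP S A) (act : S → A) (i : S) :
    M.policyReward (deterministicPolicy act) i = M.expReward i (act i) := by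
  simp [policyReward, deterministicPolicy, Pi.single_apply]

/-- The optimal value is attained simultaneously in all states by a deterministic policy. -/
theorem exists_optValue_eq [Nonempty A] (M : DMDP S A) :
    ∃ act : S → A, (∀ i, M.optValue i = M.value (deterministicPolicy act) i) ∧
      ∀ i, M.optValue i = M.actionValue M.optValue i (act i) := by
  -- The Banach fixed point `u` is a supersolution for every policy and an exact solution for the
  -- greedy one, so it is the optimal value.
  obtain ⟨u, hu⟩ : ∃ u, M.bellman u = u :=
    ⟨_, (M.contracting_bellman).fixedPoint_isFixedPt⟩
  have hact : ∀ i, ∃ a, u i = M.actionValue u i a := fun i => by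
    obtain ⟨a, -, ha⟩ := Finset.exists_mem_eq_sup' Finset.univ_nonempty (M.actionValue u i)
    exact ⟨a, (congrFun hu i).symm.trans ha⟩
  have hle : ∀ i a, M.actionValue u i a ≤ u i := fun i a =>
    (Finset.le_sup' (M.actionValue u i) (Finset.mem_univ a)).trans (congrFun hu i).le
  choose act hact using hact
  have hup : ∀ π i, M.value π i ≤ u i := fun π => M.value_le_of_supersolution π fun i => by
    calc M.policyReward π i + M.γ * ∑ j, M.policyMatrix π i j * u j
        = ∑ a, π.1 i a * M.actionValue u i a := by
          simp only [policyReward, policyMatrix, Matrix.of_apply, actionValue, mul_add,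
            Finset.sum_add_distrib, Finset.sum_mul, Finset.mul_sum]
          congr 1
          rw [Finset.sum_comm]
          exact Finset.sum_congr rfl fun a _ => Finset.sum_congr rfl fun j _ => by ring
      _ ≤ ∑ a, π.1 i a * u i := Finset.sum_le_sum fun a _ =>
          mul_le_mul_of_nonneg_left (hle i a) ((π.2 i).1 a)
      _ = u i := by rw [← Finset.sum_mul, (π.2 i).2, one_mul]
  have hval : ∀ i, M.value (deterministicPolicy act) i = u i := fun i => by
    refine (hup _ i).antisymm (M.le_value_of_subsolution _ (fun k => ?_) i)
    simp only [policyMatrix_deterministicPolicy, policyReward_deterministicPolicy]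
    exact (hact k).le
  have hopt : M.optValue = u := by
    funext i
    have : Nonempty (RandomizedPolicy S A) := ⟨deterministicPolicy act⟩
    refine (ciSup_le fun π => hup π i).antisymm ?_
    rw [← hval i]
    exact le_ciSup (f := fun π => M.value π i) ⟨u i, by rintro _ ⟨π, rfl⟩; exact hup π i⟩
      (deterministicPolicy act)
  rw [hopt]
  exact ⟨act, fun i => (hval i).symm, hact⟩

theorem optValue_nonneg [Nonempty A] (M : DMDP S A) (i : S) : 0 ≤ M.optValue i := by
  obtain ⟨act, h, -⟩ := M.exists_optValue_eq
  exact h i ▸ M.value_nonneg _ i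

theorem optValue_le [Nonempty A] (M : DMDP S A) (i : S) : M.optValue i ≤ 1 / (1 - M.γ) := by
  obtain ⟨act, h, -⟩ := M.exists_optValue_eq
  exact h i ▸ M.value_le _ i

/-! ### Occupation measures and the dual program. -/

/-- The discounted occupation equation of a Markov chain has a nonnegative solution. -/
theorem exists_occupation {P : Matrix S S ℝ} {γ : ℝ} (h0 : ∀ i j, 0 ≤ P i j)
    (h1 : ∀ i, ∑ j, P i j = 1) (hγ0 : 0 ≤ γ) (hγ1 : γ < 1) {b : S → ℝ} (hb : ∀ i, 0 ≤ b i) :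
    ∃ lam : S → ℝ, (∀ i, 0 ≤ lam i) ∧ ∀ j, lam j - γ * ∑ i, P i j * lam i = b j := by
  -- The minimum principle says that `1 - γP` is inverse positive. This yields both its injectivity
  -- and the nonnegativity of the entries of its inverse.
  have hmin : ∀ w : S → ℝ, (∀ i, 0 ≤ (1 - γ • P).mulVec w i) → ∀ i, 0 ≤ w i := fun w hw =>
    nonneg_of_discounted_le h0 h1 hγ0 hγ1 fun i => by
      have := hw i
      rw [Matrix.sub_mulVec, Matrix.one_mulVec, Matrix.smul_mulVec] at this
      exact sub_nonneg.1 this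
  have hinj : Function.Injective (1 - γ • P).mulVec := fun x y hxy => by
    funext i
    refine le_antisymm (sub_nonneg.1 (hmin (y - x) (fun k => ?_) i))
      (sub_nonneg.1 (hmin (x - y) (fun k => ?_) i)) <;>
      simp [Matrix.mulVec_sub, hxy]
  have hunit := Matrix.mulVec_injective_iff_isUnit.1 hinj
  have hdet := (Matrix.isUnit_iff_isUnit_det _).1 hunit
  refine ⟨Matrix.vecMul b (1 - γ • P)⁻¹, fun j => ?_, fun j => ?_⟩
  · refine Finset.sum_nonneg fun i _ => mul_nonneg (hb i) ?_
    have := hmin ((1 - γ • P)⁻¹.mulVec (Pi.single j 1)) (fun k => by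
      rw [Matrix.mulVec_mulVec, Matrix.mul_nonsing_inv _ hdet, Matrix.one_mulVec]
      by_cases h : k = j <;> simp [h]) i
    simpa using this
  · have h : Matrix.vecMul (Matrix.vecMul b (1 - γ • P)⁻¹) (1 - γ • P) = b := by
      rw [Matrix.vecMul_vecMul, Matrix.nonsing_inv_mul _ hdet, Matrix.vecMul_one]
    generalize Matrix.vecMul b (1 - γ • P)⁻¹ = lam at h
    have := congrFun h j
    rw [Matrix.vecMul_sub, Matrix.vecMul_one, Matrix.vecMul_smul] at this
    simpa [Matrix.vecMul, dotProduct, mul_comm] using this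

/-- The optimal value of the dual program is at least `(1 - γ) qᵀ v*`. -/
theorem le_dualObjective_of_isDualOptimal [Nonempty A] (M : DMDP S A) {q : S → ℝ}
    (hq : ∀ i, 0 ≤ q i) {μ : S → A → ℝ} (hμ : M.IsDualOptimal q μ) :
    (1 - M.γ) * ∑ i, q i * M.optValue i ≤ M.dualObjective μ := by
  obtain ⟨act, -, hact⟩ := M.exists_optValue_eq
  obtain ⟨lam, hlam0, hlam⟩ := exists_occupation (P := fun i j => M.p i (act i) j) (γ := M.γ)
    (fun i j => M.p_nonneg i _ j) (fun i => M.p_sum i _) M.γ_pos.le M.γ_lt_one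
    (b := fun i => (1 - M.γ) * q i)
    (fun i => mul_nonneg (sub_nonneg.2 M.γ_lt_one.le) (hq i))
  -- The discounted occupation measure of the greedy policy; by the Bellman equation along `act` its
  -- objective is exactly `(1-γ) qᵀv*`.
  have hfeas : M.IsDualFeasible q (fun i a => if a = act i then lam i else 0) := by
    refine ⟨fun i a => ?_, fun i => ?_⟩
    · dsimp only
      split_ifs
      exacts [hlam0 i, le_rfl]
    · rw [← hlam i, Finset.sum_sub_distrib, ← Finset.mul_sum, Finset.sum_comm]
      simp
  refine le_trans (le_of_eq ?_) (hμ.2 _ hfeas)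
  have h1 : ∀ i, M.expReward i (act i) =
      M.optValue i - M.γ * ∑ j, M.p i (act i) j * M.optValue j := fun i => by
    rw [eq_sub_iff_add_eq]
    exact (hact i).symm
  simp only [dualObjective, ite_mul, zero_mul, Finset.sum_ite_eq', Finset.mem_univ, if_true, h1]
  rw [Finset.mul_sum]
  simp_rw [← mul_assoc, ← hlam, sub_mul, mul_sub, Finset.sum_sub_distrib]
  congr 1
  simp_rw [Finset.mul_sum, Finset.sum_mul]
  rw [Finset.sum_comm]
  exact Finset.sum_congr rfl fun i _ => Finset.sum_congr rfl fun j _ => by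
    ring

/-! ### Invariants and closed forms of the updates. -/

/-- The invariants of the method: values in `[0, 1/(1-γ)]`, and positive probability vectors
`ξ` and `π_i`. -/
structure IsAdmissible (M : DMDP S A) (x : Iterate S A) : Prop where
  v_nonneg : ∀ i, 0 ≤ x.v i
  v_le : ∀ i, x.v i ≤ 1 / (1 - M.γ)
  ξ_pos : ∀ i, 0 < x.ξ i
  ξ_sum : ∑ i, x.ξ i = 1
  π_pos : ∀ i a, 0 < x.π i a
  π_sum : ∀ i, ∑ a, x.π i a = 1

theorem isAdmissible_initIterate [Nonempty S] [Nonempty A] (M : DMDP S A) :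
    M.IsAdmissible (initIterate S A) where
  v_nonneg _ := le_rfl
  v_le _ := M.horizon_nonneg
  ξ_pos _ := one_div_pos.2 (Nat.cast_pos.2 Fintype.card_pos)
  ξ_sum := by simp [initIterate]
  π_pos _ _ := one_div_pos.2 (Nat.cast_pos.2 Fintype.card_pos)
  π_sum _ := by simp [initIterate]

theorem clip_nonneg (M : DMDP S A) (x : ℝ) : 0 ≤ M.clip x := le_max_right _ _

theorem clip_le (M : DMDP S A) (x : ℝ) : M.clip x ≤ 1 / (1 - M.γ) :=
  max_le (min_le_right _ _) M.horizon_nonneg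

/-- Truncation does not increase the distance to a point of `[0, 1/(1-γ)]`. -/
theorem sq_clip_sub_le (M : DMDP S A) (x : ℝ) {y : ℝ} (h0 : 0 ≤ y) (h1 : y ≤ 1 / (1 - M.γ)) :
    (M.clip x - y) ^ 2 ≤ (x - y) ^ 2 := by
  refine sq_le_sq.2 ?_
  have h := abs_max_sub_max_le_abs (min x (1 / (1 - M.γ))) y 0
  rw [max_eq_left h0] at h
  refine h.trans ?_
  have h' := abs_inf_sub_inf_le_abs x y (1 / (1 - M.γ))
  rwa [inf_eq_left.2 h1] at h'

theorem le_clip (M : DMDP S A) {x y : ℝ} (hy : y ≤ 1 / (1 - M.γ)) (hxy : y ≤ x) :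
    y ≤ M.clip x :=
  le_max_of_le_left (le_min hxy hy)

/-- Normalizing factor of the updated row `π_i`. -/
def rowFactor (M : DMDP S A) (θ : ℝ) (q : S → ℝ) (β : ℝ) (x : Iterate S A) (z : S × A × S) : ℝ :=
  1 + x.π z.1 z.2.1 * (Real.exp (M.delta θ q β x z) - 1)

/-- Normalizing factor of the updated vector `ξ`. -/
def stateFactor (M : DMDP S A) (θ : ℝ) (q : S → ℝ) (β : ℝ) (x : Iterate S A) (z : S × A × S) :
    ℝ :=
  1 + x.ξ z.1 * (M.rowFactor θ q β x z - 1)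

namespace IsAdmissible

variable {M : DMDP S A} {x : Iterate S A} {θ β : ℝ} {q : S → ℝ}

theorem π_le_one (hx : M.IsAdmissible x) (i : S) (a : A) : x.π i a ≤ 1 := by
  rw [← hx.π_sum i]
  exact Finset.single_le_sum (fun b _ => (hx.π_pos i b).le) (Finset.mem_univ a)

theorem ξ_le_one (hx : M.IsAdmissible x) (i : S) : x.ξ i ≤ 1 := by
  rw [← hx.ξ_sum]
  exact Finset.single_le_sum (fun b _ => (hx.ξ_pos b).le) (Finset.mem_univ i)

theorem rowFactor_pos (hx : M.IsAdmissible x) (z : S × A × S) : 0 < M.rowFactor θ q β x z := by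
  have h1 := hx.π_pos z.1 z.2.1
  have h2 := hx.π_le_one z.1 z.2.1
  have h3 := mul_pos h1 (Real.exp_pos (M.delta θ q β x z))
  unfold rowFactor
  linarith

theorem stateFactor_pos (hx : M.IsAdmissible x) (z : S × A × S) :
    0 < M.stateFactor θ q β x z := by
  have h1 := hx.ξ_pos z.1
  have h2 := hx.ξ_le_one z.1
  have h3 := mul_pos h1 (hx.rowFactor_pos (θ := θ) (β := β) (q := q) z)
  unfold stateFactor
  linarith

/-- Positivity removes the absolute values from the normalization. The purely multiplicative form
turns the logarithm of the update into a sum. -/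
theorem stepXi_eq (hx : M.IsAdmissible x) (z : S × A × S) (k : S) :
    M.stepXi θ q β x z k =
      x.ξ k * (if k = z.1 then M.rowFactor θ q β x z else 1) / M.stateFactor θ q β x z := by
  have h : Function.update x.ξ z.1 (x.ξ z.1 + x.ξ z.1 * x.π z.1 z.2.1 *
      (Real.exp (M.delta θ q β x z) - 1)) =
      fun l => x.ξ l * (if l = z.1 then M.rowFactor θ q β x z else 1) := by
    funext l
    by_cases hl : l = z.1
    · subst hl
      simp [rowFactor]
      ring
    · simp [hl]
  have hpos : ∀ l, 0 < x.ξ l * (if l = z.1 then M.rowFactor θ q β x z else 1) := fun l =>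
    mul_pos (hx.ξ_pos l) (by split_ifs; exacts [hx.rowFactor_pos z, one_pos])
  have hsum : ∑ l, |x.ξ l * (if l = z.1 then M.rowFactor θ q β x z else 1)| =
      M.stateFactor θ q β x z := by
    have : ∀ l, |x.ξ l * (if l = z.1 then M.rowFactor θ q β x z else 1)| =
        x.ξ l + if l = z.1 then x.ξ l * (M.rowFactor θ q β x z - 1) else 0 := fun l => by
      rw [abs_of_pos (hpos l)]
      split_ifs <;> ring
    simp_rw [this]
    rw [Finset.sum_add_distrib, hx.ξ_sum]
    simp [stateFactor]
  simp only [stepXi, h, hsum]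

theorem stepPi_eq (hx : M.IsAdmissible x) (z : S × A × S) (k : S) (b : A) :
    M.stepPi θ q β x z k b =
      if k = z.1 then
        x.π k b * (if b = z.2.1 then Real.exp (M.delta θ q β x z) else 1) / M.rowFactor θ q β x z
      else x.π k b := by
  have h : Function.update (x.π z.1) z.2.1 (x.π z.1 z.2.1 * Real.exp (M.delta θ q β x z)) =
      fun l => x.π z.1 l * (if l = z.2.1 then Real.exp (M.delta θ q β x z) else 1) := by
    funext l
    by_cases hl : l = z.2.1
    · subst hl
      simp
    · simp [hl]
  have hpos : ∀ l, 0 < x.π z.1 l * (if l = z.2.1 then Real.exp (M.delta θ q β x z) else 1) :=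
    fun l => mul_pos (hx.π_pos _ l) (by split_ifs; exacts [Real.exp_pos _, one_pos])
  have hsum : ∑ l, |x.π z.1 l * (if l = z.2.1 then Real.exp (M.delta θ q β x z) else 1)| =
      M.rowFactor θ q β x z := by
    have : ∀ l, |x.π z.1 l * (if l = z.2.1 then Real.exp (M.delta θ q β x z) else 1)| =
        x.π z.1 l + if l = z.2.1 then x.π z.1 l * (Real.exp (M.delta θ q β x z) - 1) else 0 :=
      fun l => by
        rw [abs_of_pos (hpos l)]
        split_ifs <;> ring
    simp_rw [this]
    rw [Finset.sum_add_distrib, hx.π_sum]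
    simp [rowFactor]
  simp only [stepPi, h, hsum]
  by_cases hk : k = z.1
  · subst hk
    simp
  · simp [hk]

/-- Every step of the method preserves the invariants. -/
theorem step (hx : M.IsAdmissible x) (α : ℝ) (z : S × A × S) :
    M.IsAdmissible (M.step θ q α β x z) where
  v_nonneg i := by
    simp only [DMDP.step, stepV, Function.update_apply]
    split_ifs
    exacts [M.clip_nonneg _, M.clip_nonneg _, M.clip_nonneg _, hx.v_nonneg i]
  v_le i := by
    simp only [DMDP.step, stepV, Function.update_apply]
    split_ifs
    exacts [M.clip_le _, M.clip_le _, M.clip_le _, hx.v_le i]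
  ξ_pos i := by
    simp only [DMDP.step, hx.stepXi_eq]
    refine div_pos (mul_pos (hx.ξ_pos i) ?_) (hx.stateFactor_pos z)
    split_ifs
    exacts [hx.rowFactor_pos z, one_pos]
  ξ_sum := by
    simp only [DMDP.step, hx.stepXi_eq]
    rw [← Finset.sum_div, div_eq_one_iff_eq (hx.stateFactor_pos z).ne', stateFactor]
    have : ∀ l, x.ξ l * (if l = z.1 then M.rowFactor θ q β x z else 1) =
        x.ξ l + if l = z.1 then x.ξ l * (M.rowFactor θ q β x z - 1) else 0 := fun l => by
      split_ifs <;> ring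
    simp_rw [this]
    rw [Finset.sum_add_distrib, hx.ξ_sum]
    simp
  π_pos i a := by
    simp only [DMDP.step, hx.stepPi_eq]
    split_ifs
    exacts [div_pos (mul_pos (hx.π_pos i a) (Real.exp_pos _)) (hx.rowFactor_pos z),
      div_pos (mul_pos (hx.π_pos i a) one_pos) (hx.rowFactor_pos z), hx.π_pos i a]
  π_sum i := by
    simp only [DMDP.step, hx.stepPi_eq]
    by_cases hi : i = z.1
    · simp only [hi, if_true]
      rw [← Finset.sum_div, div_eq_one_iff_eq (hx.rowFactor_pos z).ne', rowFactor]
      have : ∀ l, x.π z.1 l * (if l = z.2.1 then Real.exp (M.delta θ q β x z) else 1) =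
          x.π z.1 l + if l = z.2.1 then x.π z.1 l * (Real.exp (M.delta θ q β x z) - 1) else 0 :=
        fun l => by split_ifs <;> ring
      simp_rw [this]
      rw [Finset.sum_add_distrib, hx.π_sum]
      simp
    · simp only [hi, if_false, hx.π_sum]

theorem stateWeight_nonneg (hx : M.IsAdmissible x) (hq : ∀ i, 0 ≤ q i) (hθ0 : 0 ≤ θ)
    (hθ1 : θ ≤ 1) (i : S) : 0 ≤ stateWeight θ q x i :=
  add_nonneg (mul_nonneg (sub_nonneg.2 hθ1) (hx.ξ_pos i).le) (mul_nonneg hθ0 (hq i))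

theorem stateWeight_sum (hx : M.IsAdmissible x) (hq : ∑ i, q i = 1) :
    ∑ i, stateWeight θ q x i = 1 := by
  simp only [stateWeight, Finset.sum_add_distrib, ← Finset.mul_sum, hx.ξ_sum, hq]
  ring

theorem dualIterate_nonneg (hx : M.IsAdmissible x) (hq : ∀ i, 0 ≤ q i) (hθ0 : 0 ≤ θ)
    (hθ1 : θ ≤ 1) (i : S) (a : A) : 0 ≤ dualIterate θ q x i a :=
  mul_nonneg (hx.stateWeight_nonneg hq hθ0 hθ1 i) (hx.π_pos i a).le

theorem sum_dualIterate (hx : M.IsAdmissible x) (i : S) :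
    ∑ a, dualIterate θ q x i a = stateWeight θ q x i := by
  simp only [dualIterate, ← Finset.mul_sum, hx.π_sum, mul_one]

theorem sampleProb_nonneg (hx : M.IsAdmissible x) (hq : ∀ i, 0 ≤ q i) (hθ0 : 0 ≤ θ)
    (hθ1 : θ ≤ 1) (z : S × A × S) : 0 ≤ M.sampleProb θ q x z :=
  mul_nonneg (hx.dualIterate_nonneg hq hθ0 hθ1 z.1 z.2.1) (M.p_nonneg _ _ _)

theorem sampleProb_sum (hx : M.IsAdmissible x) (hq : ∑ i, q i = 1) :
    ∑ z, M.sampleProb θ q x z = 1 := by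
  rw [← hx.stateWeight_sum (θ := θ) hq, Fintype.sum_prod_type]
  refine Finset.sum_congr rfl fun i _ => ?_
  rw [← hx.sum_dualIterate i, Fintype.sum_prod_type]
  refine Finset.sum_congr rfl fun a _ => ?_
  simp only [sampleProb, ← Finset.mul_sum, M.p_sum, mul_one, dualIterate]

end IsAdmissible

/-! ### Dual progress: entropy. -/

/-- Cross entropy of the current `ξ` and `π` relative to the dual solution `μ`: up to constants a
sum of relative entropies. -/
def crossEntropy (θ : ℝ) (q : S → ℝ) (μ : S → A → ℝ) (x : Iterate S A) : ℝ :=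
  -(∑ i, (∑ a, μ i a - θ * q i) * Real.log (x.ξ i)) - ∑ i, ∑ a, μ i a * Real.log (x.π i a)

theorem crossEntropy_nonneg {M : DMDP S A} {x : Iterate S A} (hx : M.IsAdmissible x) {θ : ℝ}
    {q : S → ℝ} {μ : S → A → ℝ} (hμ : μ ∈ dualSet θ q) : 0 ≤ crossEntropy θ q μ x := by
  have h1 : ∑ i, (∑ a, μ i a - θ * q i) * Real.log (x.ξ i) ≤ 0 :=
    Finset.sum_nonpos fun i _ => mul_nonpos_of_nonneg_of_nonpos (sub_nonneg.2 (hμ.2.2 i))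
      (Real.log_nonpos (hx.ξ_pos i).le (hx.ξ_le_one i))
  have h2 : ∑ i, ∑ a, μ i a * Real.log (x.π i a) ≤ 0 :=
    Finset.sum_nonpos fun i _ => Finset.sum_nonpos fun a _ =>
      mul_nonpos_of_nonneg_of_nonpos (hμ.2.1 i a)
      (Real.log_nonpos (hx.π_pos i a).le (hx.π_le_one i a))
  unfold crossEntropy
  linarith

/-- At the uniform point the value is `(1-θ) log |S| + log |A|`. -/
theorem crossEntropy_initIterate_le [Nonempty S] [Nonempty A] {θ : ℝ} (hθ : 0 ≤ θ) {q : S → ℝ}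
    (hq : ∑ i, q i = 1) {μ : S → A → ℝ} (hμ : μ ∈ dualSet θ q) :
    crossEntropy θ q μ (initIterate S A) ≤
      Real.log ((Fintype.card S : ℝ) * Fintype.card A) := by
  have hS : (1 : ℝ) ≤ Fintype.card S := Nat.one_le_cast.2 Fintype.card_pos
  have hA : (1 : ℝ) ≤ Fintype.card A := Nat.one_le_cast.2 Fintype.card_pos
  have hlog := Real.log_nonneg hS
  rw [Real.log_mul (by positivity) (by positivity)]
  simp only [crossEntropy, initIterate, one_div, Real.log_inv, ← Finset.sum_mul,
    Finset.sum_sub_distrib, ← Finset.mul_sum, hμ.1, hq]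
  nlinarith [mul_nonneg hθ hlog]

/-- Exponential updates change the cross entropy by at most `-μ_{i,a} Δ + μ^t_{i,a} (e^Δ - 1)`. -/
theorem crossEntropy_step_le {M : DMDP S A} {x : Iterate S A} (hx : M.IsAdmissible x) {θ : ℝ}
    (hθ0 : 0 ≤ θ) (hθ1 : θ ≤ 1) {q : S → ℝ} (hq0 : ∀ i, 0 ≤ q i) (hq1 : ∑ i, q i = 1)
    {μ : S → A → ℝ} (hμ : μ ∈ dualSet θ q) (α β : ℝ) (z : S × A × S) :
    crossEntropy θ q μ (M.step θ q α β x z) ≤ crossEntropy θ q μ x -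
      μ z.1 z.2.1 * M.delta θ q β x z +
      dualIterate θ q x z.1 z.2.1 * (Real.exp (M.delta θ q β x z) - 1) := by
  set Z := M.rowFactor θ q β x z with hZ
  set X := M.stateFactor θ q β x z with hX
  set D := M.delta θ q β x z with hD
  have hZpos : 0 < Z := hx.rowFactor_pos z
  have hXpos : 0 < X := hx.stateFactor_pos z
  have hξ : ∀ k, Real.log ((M.step θ q α β x z).ξ k) =
      Real.log (x.ξ k) + (if k = z.1 then Real.log Z else 0) - Real.log X := fun k => by
    simp only [step, hx.stepXi_eq]
    rw [Real.log_div (mul_pos (hx.ξ_pos k) (by split_ifs; exacts [hZpos, one_pos])).ne' hXpos.ne',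
      Real.log_mul (hx.ξ_pos k).ne' (by split_ifs; exacts [hZpos.ne', one_ne_zero])]
    split_ifs <;> simp [hZ, hX]
  have hπ : ∀ k b, Real.log ((M.step θ q α β x z).π k b) =
      Real.log (x.π k b) + if k = z.1 then (if b = z.2.1 then D else 0) - Real.log Z else 0 :=
    fun k b => by
      simp only [step, hx.stepPi_eq]
      by_cases hk : k = z.1
      · simp only [hk, if_true]
        rw [Real.log_div (mul_pos (hx.π_pos _ b)
            (by split_ifs; exacts [Real.exp_pos _, one_pos])).ne' hZpos.ne',
          Real.log_mul (hx.π_pos _ b).ne' (by split_ifs; exacts [Real.exp_ne_zero _, one_ne_zero])]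
        split_ifs <;> simp [hZ, hD] <;> ring
      · simp [hk]
  have h1 : ∑ k, (∑ a, μ k a - θ * q k) * Real.log ((M.step θ q α β x z).ξ k) =
      ∑ k, (∑ a, μ k a - θ * q k) * Real.log (x.ξ k) +
        (∑ a, μ z.1 a - θ * q z.1) * Real.log Z - (1 - θ) * Real.log X := by
    simp only [hξ, mul_sub, mul_add, Finset.sum_sub_distrib, Finset.sum_add_distrib, mul_ite,
      mul_zero, Finset.sum_ite_eq', Finset.mem_univ, if_true]
    rw [← Finset.sum_mul, Finset.sum_sub_distrib, hμ.1, ← Finset.mul_sum, hq1, mul_one]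
  have h2 : ∑ k, ∑ b, μ k b * Real.log ((M.step θ q α β x z).π k b) =
      ∑ k, ∑ b, μ k b * Real.log (x.π k b) + μ z.1 z.2.1 * D -
        (∑ b, μ z.1 b) * Real.log Z := by
    have : ∀ k, ∑ b, μ k b * Real.log ((M.step θ q α β x z).π k b) =
        ∑ b, μ k b * Real.log (x.π k b) +
          if k = z.1 then μ k z.2.1 * D - (∑ b, μ k b) * Real.log Z else 0 := fun k => by
      simp only [hπ, mul_add, Finset.sum_add_distrib]
      congr 1
      split_ifs
      · simp only [mul_sub, Finset.sum_sub_distrib, mul_ite, mul_zero, Finset.sum_ite_eq',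
          Finset.mem_univ, if_true, Finset.sum_mul]
      · simp
    simp only [this, Finset.sum_add_distrib, Finset.sum_ite_eq', Finset.mem_univ, if_true]
    ring
  -- The terms `(∑ a, μ i a) log Z` from `ξ` and `π` cancel, leaving `θ q_i log Z` and `(1-θ) log
  -- X`. After `log y ≤ y - 1` these recombine into the mixture weight `(1-θ) ξ_i + θ q_i`, which is
  -- why the weight of `log ξ_i` is reduced by `θ q_i`.
  have hlogZ : θ * q z.1 * Real.log Z ≤ θ * q z.1 * (Z - 1) :=
    mul_le_mul_of_nonneg_left (Real.log_le_sub_one_of_pos hZpos) (mul_nonneg hθ0 (hq0 _))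
  have hlogX : (1 - θ) * Real.log X ≤ (1 - θ) * (X - 1) :=
    mul_le_mul_of_nonneg_left (Real.log_le_sub_one_of_pos hXpos) (sub_nonneg.2 hθ1)
  have hfin : θ * q z.1 * (Z - 1) + (1 - θ) * (X - 1) =
      dualIterate θ q x z.1 z.2.1 * (Real.exp D - 1) := by
    simp only [hX, stateFactor, ← hZ]
    simp only [hZ, rowFactor, ← hD, dualIterate, stateWeight]
    ring
  unfold crossEntropy
  rw [h1, h2]
  linarith

/-- The temporal difference `γ v_j - v_i + r_{ij}(a) - 1/(1-γ)`. -/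
def shiftedTD (M : DMDP S A) (x : Iterate S A) (z : S × A × S) : ℝ :=
  M.γ * x.v z.2.2 - x.v z.1 + M.r z.1 z.2.1 z.2.2 - 1 / (1 - M.γ)

/-- The shift is the largest possible value of `r + γ v_j`, by `1 + γ/(1-γ) = 1/(1-γ)`. -/
theorem shiftedTD_nonpos {M : DMDP S A} {x : Iterate S A} (hx : M.IsAdmissible x)
    (z : S × A × S) : M.shiftedTD x z ≤ 0 := by
  have h := mul_le_mul_of_nonneg_left (hx.v_le z.2.2) M.γ_pos.le
  unfold shiftedTD
  linarith [hx.v_nonneg z.1, M.r_le_one z.1 z.2.1 z.2.2, M.horizon_eq]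

theorem sq_shiftedTD_le {M : DMDP S A} {x : Iterate S A} (hx : M.IsAdmissible x)
    (z : S × A × S) : M.shiftedTD x z ^ 2 ≤ 4 * (1 / (1 - M.γ)) ^ 2 := by
  have h := mul_nonneg M.γ_pos.le (hx.v_nonneg z.2.2)
  have h1 : -(2 * (1 / (1 - M.γ))) ≤ M.shiftedTD x z := by
    unfold shiftedTD
    linarith [hx.v_le z.1, M.r_nonneg z.1 z.2.1 z.2.2]
  nlinarith [shiftedTD_nonpos hx z, M.horizon_nonneg]

/-- Multiply `e^(-y) ≥ 1 - y + y²/2` by `1 + y + y²/2`: the polynomial product is `1 + y⁴/4 ≥ 1`. -/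
theorem exp_sub_one_le_of_nonpos {y : ℝ} (hy : y ≤ 0) : Real.exp y - 1 ≤ y + y ^ 2 / 2 := by
  have h := Real.quadratic_le_exp_of_nonneg (neg_nonneg.2 hy)
  have h1 : Real.exp y * Real.exp (-y) = 1 := by rw [← Real.exp_add]; simp
  have h2 : 0 < Real.exp y := Real.exp_pos y
  have h3 : Real.exp y * (1 + -y + (-y) ^ 2 / 2) ≤ 1 :=
    (mul_le_mul_of_nonneg_left h h2.le).trans_eq h1
  have h4 : 0 < 1 + -y + (-y) ^ 2 / 2 := by nlinarith [sq_nonneg y]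
  have h5 : Real.exp y ≤ 1 / (1 + -y + (-y) ^ 2 / 2) := (le_div_iff₀ h4).2 h3
  refine sub_le_iff_le_add.2 (h5.trans ((div_le_iff₀ h4).2 ?_))
  nlinarith [sq_nonneg (y ^ 2)]

/-- If a state is never sampled, then the comparison solution gives it no mass. -/
theorem eq_zero_of_stateWeight_eq_zero {M : DMDP S A} {x : Iterate S A} (hx : M.IsAdmissible x)
    {θ : ℝ} (hθ0 : 0 < θ) (hθ1 : θ ≤ 1) {q : S → ℝ} (hq0 : ∀ i, 0 ≤ q i) (hq1 : ∑ i, q i = 1)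
    {μ : S → A → ℝ} (hμ : μ ∈ dualSet θ q) {i : S} (hi : stateWeight θ q x i = 0) :
    q i = 0 ∧ ∀ a, μ i a = 0 := by
  have h1 := mul_nonneg (sub_nonneg.2 hθ1) (hx.ξ_pos i).le
  have h2 := mul_nonneg hθ0.le (hq0 i)
  unfold stateWeight at hi
  have hqi : q i = 0 := by
    have : θ * q i = 0 := by linarith
    exact (mul_eq_zero.1 this).resolve_left hθ0.ne'
  -- As `ξ_i > 0`, a vanishing weight forces `θ = 1`. Then `∑ a, μ k a ≥ q k` compares two vectors
  -- of total mass one, so equality holds everywhere.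
  have hθ : θ = 1 := by
    have : (1 - θ) * x.ξ i = 0 := by linarith
    linarith [(mul_eq_zero.1 this).resolve_right (hx.ξ_pos i).ne']
  subst hθ
  have h3 : ∑ k, (∑ a, μ k a - 1 * q k) = 0 := by
    rw [Finset.sum_sub_distrib, hμ.1, ← Finset.mul_sum, hq1]
    norm_num
  have h4 := (Finset.sum_eq_zero_iff_of_nonneg
    (fun k _ => sub_nonneg.2 (hμ.2.2 k))).1 h3 i (Finset.mem_univ i)
  rw [hqi, mul_zero, sub_zero] at h4
  exact ⟨hqi, fun a => (Finset.sum_eq_zero_iff_of_nonneg (fun b _ => hμ.2.1 i b)).1 h4 a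
    (Finset.mem_univ a)⟩

/-- Contribution of one sample to the expected change of the cross entropy. -/
theorem sampleProb_mul_crossEntropy_le {M : DMDP S A} {x : Iterate S A} (hx : M.IsAdmissible x)
    {θ : ℝ} (hθ0 : 0 < θ) (hθ1 : θ ≤ 1) {q : S → ℝ} (hq0 : ∀ i, 0 ≤ q i) (hq1 : ∑ i, q i = 1)
    {μ : S → A → ℝ} (hμ : μ ∈ dualSet θ q) (α : ℝ) {β : ℝ} (hβ : 0 ≤ β) (z : S × A × S) :
    M.sampleProb θ q x z * (crossEntropy θ q μ (M.step θ q α β x z) - crossEntropy θ q μ x) ≤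
      M.p z.1 z.2.1 z.2.2 * (β * (dualIterate θ q x z.1 z.2.1 - μ z.1 z.2.1) * M.shiftedTD x z +
        2 * β ^ 2 * (1 / (1 - M.γ)) ^ 2) := by
  have hp := M.p_nonneg z.1 z.2.1 z.2.2
  have hsq := mul_le_mul_of_nonneg_left (sq_shiftedTD_le hx z) (sq_nonneg β)
  have hw := hx.stateWeight_nonneg hq0 hθ0.le hθ1 z.1
  rcases hw.eq_or_lt with hw0 | hwpos
  · obtain ⟨-, hμ0⟩ := eq_zero_of_stateWeight_eq_zero hx hθ0 hθ1 hq0 hq1 hμ hw0.symm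
    simp only [sampleProb, dualIterate, ← hw0, hμ0, zero_mul, sub_self, mul_zero, zero_add]
    positivity
  · set m := dualIterate θ q x z.1 z.2.1 with hm
    have hmpos : 0 < m := mul_pos hwpos (hx.π_pos _ _)
    set g := M.shiftedTD x z with hg
    set D := M.delta θ q β x z with hD
    have hmD : m * D = β * g := by
      change m * (β * (g / m)) = _
      field_simp
    have hDle : D ≤ 0 :=
      nonpos_of_mul_nonpos_right (hmD ▸ mul_nonpos_of_nonneg_of_nonpos hβ (shiftedTD_nonpos hx z))
        hmpos
    have h1 := crossEntropy_step_le hx hθ0.le hθ1 hq0 hq1 hμ α β z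
    have h2 := mul_le_mul_of_nonneg_left (exp_sub_one_le_of_nonpos hDle) hmpos.le
    have h3 : crossEntropy θ q μ (M.step θ q α β x z) - crossEntropy θ q μ x ≤
        -(μ z.1 z.2.1) * D + m * (D + D ^ 2 / 2) := by linarith
    have h4 : m * (crossEntropy θ q μ (M.step θ q α β x z) - crossEntropy θ q μ x) ≤
        β * (m - μ z.1 z.2.1) * g + 2 * β ^ 2 * (1 / (1 - M.γ)) ^ 2 := by
      refine (mul_le_mul_of_nonneg_left h3 hmpos.le).trans ?_
      -- The sampling weight `m` cancels the denominator of `D`. The quadratic term becomes `(mD)²/2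
      -- = β²g²/2`, with no factor `m` left, so that summation over state-action pairs costs
      -- `|S||A|`.
      have h5 : m * (-(μ z.1 z.2.1) * D + m * (D + D ^ 2 / 2)) =
          (m - μ z.1 z.2.1) * (m * D) + (m * D) ^ 2 / 2 := by ring
      rw [h5, hmD]
      linarith
    have h6 : M.sampleProb θ q x z = M.p z.1 z.2.1 z.2.2 * m := mul_comm _ _
    rw [h6, mul_assoc]
    exact mul_le_mul_of_nonneg_left h4 hp

/-! ### Primal progress: projected stochastic gradient. -/

/-- Squared distance of the value iterate to `u`. -/
def sqDist (u : S → ℝ) (x : Iterate S A) : ℝ := ∑ i, (x.v i - u i) ^ 2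

theorem sum_sq_update_sub (f u : S → ℝ) (i : S) (c : ℝ) :
    ∑ k, (Function.update f i c k - u k) ^ 2 =
      ∑ k, (f k - u k) ^ 2 + ((c - u i) ^ 2 - (f i - u i) ^ 2) := by
  have : ∀ k, (Function.update f i c k - u k) ^ 2 =
      (f k - u k) ^ 2 + if k = i then (c - u k) ^ 2 - (f k - u k) ^ 2 else 0 := fun k => by
    by_cases h : k = i
    · subst h
      simp
    · simp [h]
  simp [this, Finset.sum_add_distrib]

/-- One step moves the value vector towards `u` up to the linear term and `2 α²`. -/
theorem sqDist_step_le {M : DMDP S A} {x : Iterate S A} (hx : M.IsAdmissible x) {θ : ℝ}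
    (hθ : 1 - M.γ ≤ θ) (hθ1 : θ ≤ 1) {q : S → ℝ} (hq0 : ∀ i, 0 ≤ q i) {u : S → ℝ}
    (hu0 : ∀ i, 0 ≤ u i) (hu1 : ∀ i, u i ≤ 1 / (1 - M.γ)) {α : ℝ} (hα : 0 ≤ α) (β : ℝ)
    (z : S × A × S) (hw : 0 < stateWeight θ q x z.1) :
    sqDist u (M.step θ q α β x z) ≤ sqDist u x -
      2 * α * (((1 - M.γ) * q z.1 / stateWeight θ q x z.1 - 1) * (x.v z.1 - u z.1) +
        M.γ * (x.v z.2.2 - u z.2.2)) + 2 * α ^ 2 := by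
  set d := (1 - M.γ) * q z.1 / stateWeight θ q x z.1 - 1 with hd
  have hγ := sub_pos.2 M.γ_lt_one
  have hd0 : -1 ≤ d := by
    have := div_nonneg (mul_nonneg hγ.le (hq0 z.1)) hw.le
    linarith
  have hd1 : d ≤ 0 := by
    -- Here `θ ≥ 1 - γ` bounds the importance weight.
    have h1 : (1 - M.γ) * q z.1 ≤ stateWeight θ q x z.1 := by
      have h2 := mul_le_mul_of_nonneg_right hθ (hq0 z.1)
      have h3 := mul_nonneg (sub_nonneg.2 hθ1) (hx.ξ_pos z.1).le
      unfold stateWeight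
      linarith
    linarith [(div_le_one hw).2 h1]
  set v₁ := Function.update x.v z.1 (M.clip (x.v z.1 - α * d)) with hv₁
  -- If `j = i`, the second update starts from the value already changed by the first. Since `d ≤
  -- 0`, the first only raises it, so replacing `v₁ j` by `v j` in the linear term goes in the right
  -- direction.
  have hmono : x.v z.2.2 ≤ v₁ z.2.2 := by
    by_cases h : z.2.2 = z.1
    · rw [hv₁, h, Function.update_self]
      exact M.le_clip (hx.v_le _) (by nlinarith)
    · rw [hv₁, Function.update_of_ne h]
  have h1 := M.sq_clip_sub_le (x.v z.1 - α * d) (hu0 z.1) (hu1 z.1)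
  have h2 := M.sq_clip_sub_le (v₁ z.2.2 - α * M.γ) (hu0 z.2.2) (hu1 z.2.2)
  have h3 : sqDist u (M.step θ q α β x z) = ∑ k, (x.v k - u k) ^ 2 +
      ((M.clip (x.v z.1 - α * d) - u z.1) ^ 2 - (x.v z.1 - u z.1) ^ 2) +
      ((M.clip (v₁ z.2.2 - α * M.γ) - u z.2.2) ^ 2 - (v₁ z.2.2 - u z.2.2) ^ 2) := by
    rw [← sum_sq_update_sub, ← sum_sq_update_sub]
    rfl
  rw [h3]
  have h4 := mul_nonneg (mul_nonneg hα M.γ_pos.le) (sub_nonneg.2 hmono)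
  have h5 : α ^ 2 * d ^ 2 ≤ α ^ 2 :=
    mul_le_of_le_one_right (sq_nonneg α) (by nlinarith)
  have h6 : α ^ 2 * M.γ ^ 2 ≤ α ^ 2 :=
    mul_le_of_le_one_right (sq_nonneg α) (by nlinarith [M.γ_pos, M.γ_lt_one])
  unfold sqDist
  nlinarith

/-- Contribution of one sample to the expected change of the squared distance. -/
theorem sampleProb_mul_sqDist_le {M : DMDP S A} {x : Iterate S A} (hx : M.IsAdmissible x) {θ : ℝ}
    (hθ : 1 - M.γ ≤ θ) (hθ1 : θ ≤ 1) {q : S → ℝ} (hq0 : ∀ i, 0 ≤ q i) {u : S → ℝ}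
    (hu0 : ∀ i, 0 ≤ u i) (hu1 : ∀ i, u i ≤ 1 / (1 - M.γ)) {α : ℝ} (hα : 0 ≤ α) (β : ℝ)
    (z : S × A × S) :
    M.sampleProb θ q x z * (sqDist u (M.step θ q α β x z) - sqDist u x) ≤
      M.p z.1 z.2.1 z.2.2 *
        (-(2 * α) * ((1 - M.γ) * q z.1 * x.π z.1 z.2.1 * (x.v z.1 - u z.1) +
          dualIterate θ q x z.1 z.2.1 *
            (M.γ * (x.v z.2.2 - u z.2.2) - (x.v z.1 - u z.1))) +
          2 * α ^ 2 * dualIterate θ q x z.1 z.2.1) := by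
  have hp := M.p_nonneg z.1 z.2.1 z.2.2
  have hθ0 : 0 < θ := (sub_pos.2 M.γ_lt_one).trans_le hθ
  have hw := hx.stateWeight_nonneg hq0 hθ0.le hθ1 z.1
  rcases hw.eq_or_lt with hw0 | hwpos
  · have hqz : q z.1 = 0 := by
      have h1 := mul_nonneg (sub_nonneg.2 hθ1) (hx.ξ_pos z.1).le
      have h2 := mul_nonneg hθ0.le (hq0 z.1)
      unfold stateWeight at hw0
      exact (mul_eq_zero.1 (by linarith : θ * q z.1 = 0)).resolve_left hθ0.ne'
    simp [sampleProb, dualIterate, ← hw0, hqz]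
  · have h1 := sqDist_step_le hx hθ hθ1 hq0 hu0 hu1 hα β z hwpos
    have h2 := mul_le_mul_of_nonneg_left (sub_le_iff_le_add'.2
      (h1.trans_eq (add_comm_sub _ _ _))) (hx.sampleProb_nonneg hq0 hθ0.le hθ1 z)
    refine h2.trans_eq ?_
    simp only [sampleProb, dualIterate]
    field_simp
    ring

/-! ### Lagrangian identities and the one-step inequality. -/

/-- The bilinear part `∑ μ_{i,a} (γ ∑_j p_{ij}(a) v_j - v_i)` of the Lagrangian. -/
def drift (M : DMDP S A) (μ : S → A → ℝ) (v : S → ℝ) : ℝ :=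
  ∑ i, ∑ a, μ i a * (M.γ * ∑ j, M.p i a j * v j - v i)

/-- The dual constraints tested against `v`; the answer depends on `μ` only through feasibility. -/
theorem IsDualFeasible.drift_eq {M : DMDP S A} {q : S → ℝ} {μ : S → A → ℝ}
    (hμ : M.IsDualFeasible q μ) (v : S → ℝ) :
    M.drift μ v = -((1 - M.γ) * ∑ i, q i * v i) := by
  have h : (1 - M.γ) * ∑ i, q i * v i =
      ∑ i, ∑ a, μ i a * v i - ∑ i, ∑ a, ∑ k, M.γ * (M.p k a i * μ k a) * v i := by
    rw [Finset.mul_sum, ← Finset.sum_sub_distrib]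
    refine Finset.sum_congr rfl fun i _ => ?_
    rw [← mul_assoc, ← hμ.2 i, Finset.sum_mul, ← Finset.sum_sub_distrib]
    exact Finset.sum_congr rfl fun a _ => by rw [sub_mul, Finset.mul_sum, Finset.sum_mul]
  have h2 : ∑ i, ∑ a, ∑ k, M.γ * (M.p k a i * μ k a) * v i =
      ∑ i, ∑ a, μ i a * (M.γ * ∑ j, M.p i a j * v j) := by
    rw [Finset.sum_comm' (t' := Finset.univ) (s' := fun _ => Finset.univ) (by simp)]
    rw [Finset.sum_comm (s := (Finset.univ : Finset S))]
    refine Finset.sum_congr rfl fun a _ => ?_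
    rw [Finset.sum_comm]
    refine Finset.sum_congr rfl fun k _ => ?_
    rw [Finset.mul_sum, Finset.mul_sum]
    exact Finset.sum_congr rfl fun j _ => by ring
  rw [h, h2, drift]
  simp only [mul_sub, Finset.sum_sub_distrib]
  ring

theorem gap_eq (M : DMDP S A) (μ : S → A → ℝ) :
    M.gap μ = -M.drift μ M.optValue - M.dualObjective μ := by
  simp only [gap, drift, dualObjective, expReward, ← Finset.sum_neg_distrib,
    ← Finset.sum_sub_distrib]
  exact Finset.sum_congr rfl fun i _ => Finset.sum_congr rfl fun a _ => by ring

/-- The constant shift drops out because `m` and `μ` have equal mass. -/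
theorem sum_shiftedTD (M : DMDP S A) (x : Iterate S A) (m μ : S → A → ℝ)
    (hm : ∑ i, ∑ a, m i a = ∑ i, ∑ a, μ i a) (β c : ℝ) :
    ∑ z : S × A × S, M.p z.1 z.2.1 z.2.2 *
        (β * (m z.1 z.2.1 - μ z.1 z.2.1) * M.shiftedTD x z + c) =
      β * (M.drift m x.v + M.dualObjective m - M.drift μ x.v - M.dualObjective μ) +
        c * (Fintype.card S * Fintype.card A) := by
  have h : ∀ i a, ∑ j, M.p i a j * (β * (m i a - μ i a) * M.shiftedTD x (i, a, j) + c) =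
      β * (m i a * (M.γ * ∑ j, M.p i a j * x.v j - x.v i) + m i a * M.expReward i a -
        μ i a * (M.γ * ∑ j, M.p i a j * x.v j - x.v i) - μ i a * M.expReward i a) -
        β * (1 / (1 - M.γ)) * (m i a - μ i a) + c := fun i a => by
    have h1 : ∀ j, M.p i a j * (β * (m i a - μ i a) * M.shiftedTD x (i, a, j) + c) =
        β * (m i a - μ i a) * M.γ * (M.p i a j * x.v j) +
          β * (m i a - μ i a) * (M.p i a j * M.r i a j) +
          (β * (m i a - μ i a) * (-x.v i - 1 / (1 - M.γ)) + c) * M.p i a j := fun j => by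
      simp only [shiftedTD]
      ring
    simp only [h1, Finset.sum_add_distrib, ← Finset.mul_sum, M.p_sum, expReward]
    ring
  simp only [Fintype.sum_prod_type, h, Finset.sum_add_distrib, Finset.sum_sub_distrib,
    ← Finset.mul_sum, hm, drift, dualObjective]
  simp
  ring

/-- The importance-weighted term averages to `(1-γ) q` since each `π_i` has mass one. The error is
`2α²` in total, not per pair, because the dual iterate has mass one. -/
theorem sum_primal_linear {M : DMDP S A} {x : Iterate S A} (hx : M.IsAdmissible x) {θ : ℝ}
    {q : S → ℝ} (hq1 : ∑ i, q i = 1) (u : S → ℝ) (α : ℝ) :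
    ∑ z : S × A × S, M.p z.1 z.2.1 z.2.2 *
        (-(2 * α) * ((1 - M.γ) * q z.1 * x.π z.1 z.2.1 * (x.v z.1 - u z.1) +
          dualIterate θ q x z.1 z.2.1 *
            (M.γ * (x.v z.2.2 - u z.2.2) - (x.v z.1 - u z.1))) +
          2 * α ^ 2 * dualIterate θ q x z.1 z.2.1) =
      -(2 * α) * ((1 - M.γ) * ∑ i, q i * x.v i - (1 - M.γ) * ∑ i, q i * u i +
        M.drift (dualIterate θ q x) x.v - M.drift (dualIterate θ q x) u) + 2 * α ^ 2 := by
  have h : ∀ i a, ∑ j, M.p i a j *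
        (-(2 * α) * ((1 - M.γ) * q i * x.π i a * (x.v i - u i) +
          dualIterate θ q x i a * (M.γ * (x.v j - u j) - (x.v i - u i))) +
          2 * α ^ 2 * dualIterate θ q x i a) =
      -(2 * α) * ((1 - M.γ) * q i * (x.v i - u i) * x.π i a +
        dualIterate θ q x i a * (M.γ * ∑ j, M.p i a j * x.v j - x.v i) -
        dualIterate θ q x i a * (M.γ * ∑ j, M.p i a j * u j - u i)) +
        2 * α ^ 2 * dualIterate θ q x i a := fun i a => by
    have h1 : ∀ j, M.p i a j *
        (-(2 * α) * ((1 - M.γ) * q i * x.π i a * (x.v i - u i) +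
          dualIterate θ q x i a * (M.γ * (x.v j - u j) - (x.v i - u i))) +
          2 * α ^ 2 * dualIterate θ q x i a) =
        -(2 * α) * dualIterate θ q x i a * M.γ * (M.p i a j * x.v j) -
        -(2 * α) * dualIterate θ q x i a * M.γ * (M.p i a j * u j) +
        (-(2 * α) * ((1 - M.γ) * q i * x.π i a * (x.v i - u i) -
          dualIterate θ q x i a * (x.v i - u i)) +
          2 * α ^ 2 * dualIterate θ q x i a) * M.p i a j := fun j => by ring
    simp only [h1, Finset.sum_add_distrib, Finset.sum_sub_distrib, ← Finset.mul_sum, M.p_sum]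
    ring
  have h2 : ∑ i, ∑ a, dualIterate θ q x i a = 1 := by
    simp only [hx.sum_dualIterate, hx.stateWeight_sum hq1]
  simp only [Fintype.sum_prod_type, h, Finset.sum_add_distrib, Finset.sum_sub_distrib,
    ← Finset.mul_sum, h2, hx.π_sum, drift]
  simp only [mul_one, mul_assoc, ← Finset.mul_sum, mul_sub, Finset.sum_sub_distrib]

/-- The potential of the primal-dual method: cross entropy plus squared distance to `v*`. -/
def potential (M : DMDP S A) (θ : ℝ) (q : S → ℝ) (μ : S → A → ℝ) (α β : ℝ) (x : Iterate S A) : ℝ :=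
  crossEntropy θ q μ x / β + sqDist M.optValue x / (2 * α)

/-- In one iteration the potential decreases in expectation by the complementarity violation of
the current dual iterate, up to an error that is linear in the step sizes. -/
theorem sum_sampleProb_mul_potential_le [Nonempty A] {M : DMDP S A} {x : Iterate S A}
    (hx : M.IsAdmissible x) {θ : ℝ} (hθ : 1 - M.γ ≤ θ) (hθ1 : θ ≤ 1) {q : S → ℝ}
    (hq0 : ∀ i, 0 ≤ q i) (hq1 : ∑ i, q i = 1) {μ : S → A → ℝ} (hopt : M.IsDualOptimal q μ)
    (hμ : μ ∈ dualSet θ q) {α β : ℝ} (hα : 0 < α) (hβ : 0 < β) :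
    ∑ z, M.sampleProb θ q x z * M.potential θ q μ α β (M.step θ q α β x z) ≤
      M.potential θ q μ α β x - M.gap (dualIterate θ q x) +
        (α + 2 * β * (Fintype.card S * Fintype.card A) * (1 / (1 - M.γ)) ^ 2) := by
  have hθ0 : 0 < θ := (sub_pos.2 M.γ_lt_one).trans_le hθ
  have hD := M.le_dualObjective_of_isDualOptimal hq0 hopt
  have hdual := Finset.sum_le_sum fun z (_ : z ∈ Finset.univ) =>
    sampleProb_mul_crossEntropy_le hx hθ0 hθ1 hq0 hq1 hμ α hβ.le z
  have hm1 : ∑ i, ∑ a, dualIterate θ q x i a = ∑ i, ∑ a, μ i a := by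
    simp only [hx.sum_dualIterate, hx.stateWeight_sum hq1, hμ.1]
  rw [sum_shiftedTD M x _ _ hm1, hopt.1.drift_eq] at hdual
  have hprimal := Finset.sum_le_sum fun z (_ : z ∈ Finset.univ) =>
    sampleProb_mul_sqDist_le hx hθ hθ1 hq0 M.optValue_nonneg M.optValue_le hα.le β z
  rw [sum_primal_linear hx hq1] at hprimal
  have hsplit : ∑ z, M.sampleProb θ q x z * M.potential θ q μ α β (M.step θ q α β x z) =
      M.potential θ q μ α β x +
      (∑ z, M.sampleProb θ q x z *
        (crossEntropy θ q μ (M.step θ q α β x z) - crossEntropy θ q μ x)) / β +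
      (∑ z, M.sampleProb θ q x z *
        (sqDist M.optValue (M.step θ q α β x z) - sqDist M.optValue x)) / (2 * α) := by
    conv_rhs => rw [← one_mul (M.potential θ q μ α β x), ← hx.sampleProb_sum (θ := θ) hq1]
    rw [Finset.sum_mul, Finset.sum_div, Finset.sum_div, ← Finset.sum_add_distrib,
      ← Finset.sum_add_distrib]
    refine Finset.sum_congr rfl fun z _ => ?_
    unfold potential
    ring
  have hd := div_le_div_of_nonneg_right hdual hβ.le
  have hp := div_le_div_of_nonneg_right hprimal (mul_pos two_pos hα).le
  rw [hsplit, gap_eq]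
  refine (add_le_add (add_le_add_right hd _) hp).trans ?_
  field_simp
  -- All terms containing `x.v` have cancelled; only the bound on the dual optimum is left to use.
  nlinarith [mul_le_mul_of_nonneg_left hD (mul_pos hα hβ).le]

/-! ### Path expectations and telescoping. -/

/-- Causality: iterates up to index `T` do not depend on the sample drawn from iterate `T`. This
allows conditioning on the first `T` samples. -/
theorem iterate_snoc (M : DMDP S A) (θ : ℝ) (q : S → ℝ) (α β : ℝ) {T : ℕ}
    (ω : Fin T → S × A × S) (z : S × A × S) {t : ℕ} (ht : t ≤ T) :
    M.iterate θ q α β (Fin.snoc ω z : Fin (T + 1) → S × A × S) t = M.iterate θ q α β ω t := by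
  induction t with
  | zero => rfl
  | succ t ih =>
    have h1 : t < T := ht
    have h2 : (Fin.snoc ω z : Fin (T + 1) → S × A × S) ⟨t, h1.trans T.lt_succ_self⟩ =
        ω ⟨t, h1⟩ := Fin.snoc_castSucc (α := fun _ => S × A × S) z ω ⟨t, h1⟩
    rw [iterate, iterate, dif_pos (h1.trans T.lt_succ_self), dif_pos h1, ih h1.le, h2]

theorem iterate_snoc_last (M : DMDP S A) (θ : ℝ) (q : S → ℝ) (α β : ℝ) {T : ℕ}
    (ω : Fin T → S × A × S) (z : S × A × S) :
    M.iterate θ q α β (Fin.snoc ω z : Fin (T + 1) → S × A × S) (T + 1) =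
      M.step θ q α β (M.iterate θ q α β ω T) z := by
  have h2 : (Fin.snoc ω z : Fin (T + 1) → S × A × S) ⟨T, T.lt_succ_self⟩ = z :=
    Fin.snoc_last (α := fun _ => S × A × S) z ω
  rw [iterate, dif_pos T.lt_succ_self, M.iterate_snoc θ q α β ω z le_rfl, h2]

theorem pathProb_snoc (M : DMDP S A) (θ : ℝ) (q : S → ℝ) (α β : ℝ) {T : ℕ}
    (ω : Fin T → S × A × S) (z : S × A × S) :
    M.pathProb θ q α β (Fin.snoc ω z : Fin (T + 1) → S × A × S) =
      M.pathProb θ q α β ω * M.sampleProb θ q (M.iterate θ q α β ω T) z := by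
  unfold pathProb
  rw [Fin.prod_univ_castSucc]
  simp [iterate_snoc, Fin.is_le']

/-- The expectation over `T + 1` iterations, conditioned on the first `T` iterations. -/
theorem expectation_succ (M : DMDP S A) (θ : ℝ) (q : S → ℝ) (α β : ℝ) (T : ℕ)
    (f : (Fin (T + 1) → S × A × S) → ℝ) :
    M.expectation θ q α β (T + 1) f = M.expectation θ q α β T fun ω =>
      ∑ z, M.sampleProb θ q (M.iterate θ q α β ω T) z * f (Fin.snoc ω z) := by
  unfold expectation
  rw [← (Fin.snocEquiv fun _ => S × A × S).sum_comp, Fintype.sum_prod_type_right]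
  refine Finset.sum_congr rfl fun ω _ => ?_
  rw [Finset.mul_sum]
  refine Finset.sum_congr rfl fun z _ => ?_
  rw [← mul_assoc, ← pathProb_snoc]
  rfl

theorem isAdmissible_iterate [Nonempty S] [Nonempty A] (M : DMDP S A) (θ : ℝ) (q : S → ℝ)
    (α β : ℝ) {T : ℕ} (ω : Fin T → S × A × S) (t : ℕ) :
    M.IsAdmissible (M.iterate θ q α β ω t) := by
  induction t with
  | zero => exact M.isAdmissible_initIterate
  | succ t ih =>
    rw [iterate]
    split_ifs
    exacts [ih.step α _, ih]

theorem pathProb_nonneg [Nonempty S] [Nonempty A] (M : DMDP S A) {θ : ℝ} (hθ0 : 0 ≤ θ)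
    (hθ1 : θ ≤ 1) {q : S → ℝ} (hq0 : ∀ i, 0 ≤ q i) (α β : ℝ) {T : ℕ} (ω : Fin T → S × A × S) :
    0 ≤ M.pathProb θ q α β ω :=
  Finset.prod_nonneg fun _ _ =>
    (M.isAdmissible_iterate θ q α β ω _).sampleProb_nonneg hq0 hθ0 hθ1 _

/-- Telescoping a one-step expected decrease of a potential along the iterations. -/
theorem expectation_sum_add_le [Nonempty S] [Nonempty A] (M : DMDP S A) {θ : ℝ} (hθ0 : 0 ≤ θ)
    (hθ1 : θ ≤ 1) {q : S → ℝ} (hq0 : ∀ i, 0 ≤ q i) (hq1 : ∑ i, q i = 1) (α β : ℝ)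
    {Ψ G : Iterate S A → ℝ} {c : ℝ}
    (h : ∀ x, M.IsAdmissible x →
      ∑ z, M.sampleProb θ q x z * Ψ (M.step θ q α β x z) ≤ Ψ x - G x + c) (T : ℕ) :
    M.expectation θ q α β T (fun ω =>
      ∑ t : Fin T, G (M.iterate θ q α β ω t) + Ψ (M.iterate θ q α β ω T)) ≤
      Ψ (initIterate S A) + T * c := by
  have hone : ∀ n, M.expectation θ q α β n (fun _ => 1) = 1 := fun n => by
    induction n with
    | zero => simp [expectation, pathProb]
    | succ n ih =>
      rw [expectation_succ]
      simpa only [mul_one, (M.isAdmissible_iterate θ q α β _ _).sampleProb_sum hq1] using ih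
  induction T with
  | zero => simp [expectation, pathProb, iterate]
  | succ T ih =>
    rw [expectation_succ]
    have hle : M.expectation θ q α β T (fun ω =>
        ∑ z, M.sampleProb θ q (M.iterate θ q α β ω T) z *
          (∑ t : Fin (T + 1), G (M.iterate θ q α β
              (Fin.snoc ω z : Fin (T + 1) → S × A × S) t) +
            Ψ (M.iterate θ q α β (Fin.snoc ω z : Fin (T + 1) → S × A × S) (T + 1)))) ≤
        M.expectation θ q α β T (fun ω =>
          (∑ t : Fin T, G (M.iterate θ q α β ω t) + Ψ (M.iterate θ q α β ω T)) + c * 1) := by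
      refine Finset.sum_le_sum fun ω _ =>
        mul_le_mul_of_nonneg_left ?_ (M.pathProb_nonneg hθ0 hθ1 hq0 α β ω)
      have hx := M.isAdmissible_iterate θ q α β ω T
      simp only [iterate_snoc_last, Fin.sum_univ_castSucc, Fin.val_castSucc, Fin.val_last,
        iterate_snoc, Fin.is_le', le_refl, mul_add, Finset.sum_add_distrib, ← Finset.sum_mul,
        hx.sampleProb_sum hq1, one_mul]
      linarith [h _ hx]
    refine hle.trans ?_
    have hc : M.expectation θ q α β T (fun ω =>
          (∑ t : Fin T, G (M.iterate θ q α β ω t) + Ψ (M.iterate θ q α β ω T)) + c * 1) =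
        M.expectation θ q α β T (fun ω =>
          ∑ t : Fin T, G (M.iterate θ q α β ω t) + Ψ (M.iterate θ q α β ω T)) +
        c * M.expectation θ q α β T (fun _ => 1) := by
      simp only [expectation, Finset.mul_sum, ← Finset.sum_add_distrib]
      exact Finset.sum_congr rfl fun ω _ => by ring
    rw [hc, hone]
    push_cast
    linarith

theorem gap_avgDual (M : DMDP S A) (θ : ℝ) (q : S → ℝ) (α β : ℝ) {T : ℕ}
    (ω : Fin T → S × A × S) :
    M.gap (M.avgDual θ q α β ω) =
      1 / (T : ℝ) * ∑ t : Fin T, M.gap (dualIterate θ q (M.iterate θ q α β ω t)) := by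
  simp only [gap, avgDual, Finset.mul_sum, Finset.sum_mul, mul_assoc]
  rw [Finset.sum_comm]
  simp only [Finset.sum_comm (s := (Finset.univ : Finset (Fin T)))]
  rw [Finset.sum_comm]

/-- Expected complementarity violation of the averaged dual iterate for arbitrary step sizes. -/
theorem expectation_gap_avgDual_le [Nonempty S] [Nonempty A] (M : DMDP S A) {θ : ℝ}
    (hθ : 1 - M.γ ≤ θ) (hθ1 : θ ≤ 1) {q : S → ℝ} (hq0 : ∀ i, 0 ≤ q i) (hq1 : ∑ i, q i = 1)
    {μ : S → A → ℝ} (hopt : M.IsDualOptimal q μ) (hμ : μ ∈ dualSet θ q) {α β : ℝ} (hα : 0 < α)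
    (hβ : 0 < β) {T : ℕ} (hT : 1 ≤ T) :
    M.expectation θ q α β T (fun ω => M.gap (M.avgDual θ q α β ω)) ≤
      (Real.log ((Fintype.card S : ℝ) * Fintype.card A) / β +
        Fintype.card S * (1 / (1 - M.γ)) ^ 2 / (2 * α)) / T +
        (α + 2 * β * (Fintype.card S * Fintype.card A) * (1 / (1 - M.γ)) ^ 2) := by
  have hθ0 : 0 < θ := (sub_pos.2 M.γ_lt_one).trans_le hθ
  have hT0 : (0 : ℝ) < T := Nat.cast_pos.2 hT
  have hpot : ∀ x, M.IsAdmissible x → 0 ≤ M.potential θ q μ α β x := fun x hx =>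
    add_nonneg (div_nonneg (crossEntropy_nonneg hx hμ) hβ.le)
      (div_nonneg (Finset.sum_nonneg fun i _ => sq_nonneg _) (mul_pos two_pos hα).le)
  have hinit : M.potential θ q μ α β (initIterate S A) ≤
      Real.log ((Fintype.card S : ℝ) * Fintype.card A) / β +
        Fintype.card S * (1 / (1 - M.γ)) ^ 2 / (2 * α) := by
    refine add_le_add (div_le_div_of_nonneg_right (crossEntropy_initIterate_le hθ0.le hq1 hμ)
      hβ.le) (div_le_div_of_nonneg_right ?_ (mul_pos two_pos hα).le)
    calc sqDist M.optValue (initIterate S A) ≤ ∑ _ : S, (1 / (1 - M.γ)) ^ 2 := by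
          refine Finset.sum_le_sum fun i _ => ?_
          simp only [initIterate, zero_sub, neg_sq]
          exact pow_le_pow_left₀ (M.optValue_nonneg i) (M.optValue_le i) 2
      _ = _ := by simp
  have htel := M.expectation_sum_add_le hθ0.le hθ1 hq0 hq1 α β
    (fun x hx => sum_sampleProb_mul_potential_le hx hθ hθ1 hq0 hq1 hopt hμ hα hβ) T
  have hle : M.expectation θ q α β T (fun ω => M.gap (M.avgDual θ q α β ω)) ≤
      1 / (T : ℝ) * M.expectation θ q α β T (fun ω =>
        ∑ t : Fin T, M.gap (dualIterate θ q (M.iterate θ q α β ω t)) +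
          M.potential θ q μ α β (M.iterate θ q α β ω T)) := by
    simp only [expectation, gap_avgDual]
    rw [Finset.mul_sum]
    refine Finset.sum_le_sum fun ω _ => ?_
    rw [mul_left_comm]
    refine mul_le_mul_of_nonneg_left (mul_le_mul_of_nonneg_left ?_
      (M.pathProb_nonneg hθ0.le hθ1 hq0 α β ω)) (by positivity)
    -- The terminal potential is discarded, being nonnegative.
    linarith [hpot _ (M.isAdmissible_iterate θ q α β ω T)]
  refine hle.trans ((mul_le_mul_of_nonneg_left (htel.trans (add_le_add_left hinit _))
    (by positivity)).trans_eq ?_)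
  field_simp

end DMDP

/-! ### Step sizes and the constant. -/

/-- The choice of the dual step size balances the regret terms. -/
theorem balanced_steps_le {s a T l L : ℝ} (hs : 1 ≤ s) (ha : 1 ≤ a) (hT : 0 < T) (hl : 0 < l)
    (hlL : l ≤ L) (hLl : L ≤ 2 * l) :
    L / (√(l / (2 * s * a * T)) * T) + √(l / (2 * s * a * T)) * s * (4 * a + 1) / 2 ≤
      3 * √(s * (a + 1) * L) / √T := by
  have hL := hl.trans_le hlL
  set b := √(l / (2 * s * a * T)) with hb
  have hbpos : 0 < b := Real.sqrt_pos.2 (by positivity)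
  have hb2 : b ^ 2 = l / (2 * s * a * T) := Real.sq_sqrt (by positivity)
  refine le_of_sq_le_sq ?_ (by positivity)
  have h1 : (3 * √(s * (a + 1) * L) / √T) ^ 2 = 9 * (s * (a + 1) * L) / T := by
    rw [div_pow, mul_pow, Real.sq_sqrt (by positivity), Real.sq_sqrt hT.le]
    norm_num
  have h2 : (L / (b * T) + b * s * (4 * a + 1) / 2) ^ 2 =
      s / T * (2 * a * L ^ 2 / l + L * (4 * a + 1) + l * (4 * a + 1) ^ 2 / (8 * a)) := by
    have : (L / (b * T) + b * s * (4 * a + 1) / 2) ^ 2 =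
        L ^ 2 / (b ^ 2 * T ^ 2) + L * s * (4 * a + 1) / T + b ^ 2 * s ^ 2 * (4 * a + 1) ^ 2 / 4 := by
      field_simp
      ring
    rw [this, hb2]
    field_simp
    ring
  -- With `x = L/l ∈ [1, 2]` this is `x + 1/x ≤ 5/2`, sharp at `x = 2`. The leading coefficient of
  -- `aL` in the square is then `5 + 4 = 9`, whose root is the constant 3.
  have h3 : L ^ 2 / l + l ≤ 5 / 2 * L := by
    rw [← sub_nonneg]
    have : 5 / 2 * L - (L ^ 2 / l + l) = (2 * l - L) * (L - l / 2) / l := by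
      field_simp
      ring
    rw [this]
    exact div_nonneg (mul_nonneg (by linarith) (by linarith)) hl.le
  have h4 : l * (4 * a + 1) ^ 2 / (8 * a) ≤ 2 * a * l + 9 / 8 * L := by
    rw [div_le_iff₀ (by positivity)]
    nlinarith [mul_le_mul_of_nonneg_right hlL (by linarith : (0 : ℝ) ≤ a),
      mul_le_mul_of_nonneg_left ha hl.le]
  have h5 : 2 * a * L ^ 2 / l = 2 * a * (L ^ 2 / l) := by ring
  have h6 : 9 * (s * (a + 1) * L) / T = s / T * (9 * (a + 1) * L) := by ring
  rw [h1, h2, h6, h5]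
  refine mul_le_mul_of_nonneg_left ?_ (by positivity)
  nlinarith [mul_le_mul_of_nonneg_left h3 (by linarith : (0 : ℝ) ≤ 2 * a)]

/-- Exponentiated, this is `e n ≤ (n + 1)²`, which follows from `e < 4` and `4n ≤ (n + 1)²`. -/
theorem log_add_one_le_two_mul_log {n : ℝ} (hn : 1 ≤ n) :
    Real.log n + 1 ≤ 2 * Real.log (n + 1) := by
  have h1 : Real.log n + 1 = Real.log (n * Real.exp 1) := by
    rw [Real.log_mul (by positivity) (Real.exp_ne_zero 1), Real.log_exp]
  have h2 : 2 * Real.log (n + 1) = Real.log ((n + 1) ^ 2) := by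
    rw [Real.log_pow]
    norm_num
  rw [h1, h2]
  refine Real.log_le_log (by positivity) ?_
  nlinarith [Real.exp_one_lt_d9, sq_nonneg (n - 1)]

theorem log_add_one_le {n : ℝ} (hn : 1 ≤ n) : Real.log (n + 1) ≤ Real.log n + 1 := by
  have h1 : Real.log n + 1 = Real.log (n * Real.exp 1) := by
    rw [Real.log_mul (by positivity) (Real.exp_ne_zero 1), Real.log_exp]
  rw [h1]
  refine Real.log_le_log (by positivity) ?_
  nlinarith [Real.add_one_le_exp (1 : ℝ)]

end

theorem mainTheorem4 {S A : Type*} [Fintype S] [Fintype A] [DecidableEq S] [DecidableEq A]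
    (M : DMDP S A) (q : S → ℝ) (hq : q ∈ stdSimplex ℝ S) (θ : ℝ) (hθ : 1 - M.γ ≤ θ)
    (μopt : S → A → ℝ) (hopt : M.IsDualOptimal q μopt) (hmem : μopt ∈ dualSet θ q)
    (T : ℕ) (hT : 1 ≤ T) (ℓ : ℝ)
    (hℓ : ℓ = Real.log ((Fintype.card S : ℝ) * Fintype.card A + 1) ∨
      ℓ = Real.log ((Fintype.card S : ℝ) * Fintype.card A) + 1) :
    M.expectation θ q (M.primalStep ℓ T) (M.dualStep ℓ T) T
        (fun ω => M.gap (M.avgDual θ q (M.primalStep ℓ T) (M.dualStep ℓ T) ω)) ≤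
      3 * √((Fintype.card S : ℝ) * (Fintype.card A + 1) *
          (Real.log ((Fintype.card S : ℝ) * Fintype.card A) + 1)) /
        ((1 - M.γ) * √(T : ℝ)) := by
  have hS : Nonempty S := by
    by_contra h
    rw [not_nonempty_iff] at h
    simpa using hq.2
  have hA : Nonempty A := by
    by_contra h
    rw [not_nonempty_iff] at h
    simpa using hmem.1
  -- Summing the constraints `θ q_i ≤ ∑ a, μ i a` over the states.
  have hθ1 : θ ≤ 1 := by
    have h := Finset.sum_le_sum fun i (_ : i ∈ Finset.univ) => hmem.2.2 i
    rwa [hmem.1, ← Finset.mul_sum, hq.2, mul_one] at h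
  have hs : (1 : ℝ) ≤ Fintype.card S := Nat.one_le_cast.2 Fintype.card_pos
  have ha : (1 : ℝ) ≤ Fintype.card A := Nat.one_le_cast.2 Fintype.card_pos
  have hn : (1 : ℝ) ≤ (Fintype.card S : ℝ) * Fintype.card A := one_le_mul_of_one_le_of_one_le hs ha
  have hT0 : (0 : ℝ) < T := Nat.cast_pos.2 hT
  have hγ : 0 < 1 - M.γ := sub_pos.2 M.γ_lt_one
  have hL1 := Real.log_nonneg hn
  have hbounds : 0 < ℓ ∧ ℓ ≤ Real.log ((Fintype.card S : ℝ) * Fintype.card A) + 1 ∧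
      Real.log ((Fintype.card S : ℝ) * Fintype.card A) + 1 ≤ 2 * ℓ := by
    rcases hℓ with rfl | rfl
    · exact ⟨Real.log_pos (by linarith), log_add_one_le hn, log_add_one_le_two_mul_log hn⟩
    · exact ⟨by linarith, le_rfl, by linarith⟩
  obtain ⟨hℓ0, hℓL, hLℓ⟩ := hbounds
  have hb : 0 < √(ℓ / (2 * Fintype.card S * Fintype.card A * T)) :=
    Real.sqrt_pos.2 (by positivity)
  have hβ : 0 < M.dualStep ℓ T := mul_pos hγ hb
  have hα : 0 < M.primalStep ℓ T := mul_pos (by positivity) hβ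
  refine (M.expectation_gap_avgDual_le hθ hθ1 hq.1 hq.2 hopt hmem hα hβ hT).trans ?_
  have h := mul_le_mul_of_nonneg_left (balanced_steps_le hs ha hT0 hℓ0 hℓL hLℓ)
    (one_div_nonneg.2 hγ.le)
  refine (le_of_eq ?_).trans (h.trans_eq ?_)
  -- With `β = (1-γ)b` and `α = |S|b/(2(1-γ))`, the initial squared distance contributes
  -- `1/((1-γ)bT)`. This is the `+1` that completes `log(|S||A|)` to `L`.
  · unfold DMDP.primalStep DMDP.dualStep
    generalize √(ℓ / (2 * Fintype.card S * Fintype.card A * T)) = b at hb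
    field_simp
    ring
  · field_simp
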